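/- Let $n,p,m,q$ be dimensions, let $A\in\mathbb C^{n\times p}$, $B\in\mathbb C^{m\times q}$, $C\in\mathbb C^{n\times q}$, and let $D\in\mathbb C^{n\times n}$ and $M\in\mathbb C^{q\times q}$ be Hermitian. For $X\in\mathbb C^{p\times m}$ put $$\phi(X)=(AXB+C)\,M\,(AXB+C)^*+D .$$ Write $r(\cdot)$ for the rank of a matrix and, for a Hermitian matrix $H$, write $i_+(H)$ and $i_-(H)$ for the numbers of positive and of negative eigenvalues of $H$, counted with multiplicity. Define $$N_1=\begin{bmatrix} D+CMC^* & A\\ A^* & 0\end{bmatrix},\qquad N_2=\begin{bmatrix} D+CMC^* & CMB^* & A\\ A^* & 0 & 0\end{bmatrix},$$ $$N_3=\begin{bmatrix} D+CMC^* & CMB^*\\ BMC^* & BMB^*\end{bmatrix},\qquad N_4=\begin{bmatrix} D+CMC^* & CMB^* & A\\ BMC^* & BMB^* & 0\end{bmatrix},$$ and $r_0=r[\,D+CMC^*,\;CMB^*,\;A\,]$. Then the following maxima and minima over all $X\in\mathbb C^{p\times m}$ are attained and are given by $$\max_X r[\phi(X)]=\min\{\,r_0,\ r(N_1),\ r(N_3)\,\},$$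 $$\min_X r[\phi(X)]=2r_0+\max\{\,s_1,\ s_2,\ s_3,\ s_4\,\},$$ $$\max_X i_\pm[\phi(X)]=\min\{\,i_\pm(N_1),\ i_\pm(N_3)\,\},$$ $$\min_X i_\pm[\phi(X)]=r_0+\max\{\,i_\pm(N_1)-r(N_2),\ i_\pm(N_3)-r(N_4)\,\},$$ where the formulas with $\pm$ hold separately for $+$ and for $-$, and $$s_1=r(N_1)-2r(N_2),\qquad s_2=r(N_3)-2r(N_4),$$ $$s_3=i_+(N_1)+i_-(N_3)-r(N_2)-r(N_4),\qquad s_4=i_-(N_1)+i_+(N_3)-r(N_2)-r(N_4).$$ -/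

import Mathlib

open Matrix

namespace QuadInertia

noncomputable section

/-- The number of positive eigenvalues, counted with multiplicity, of a Hermitian matrix. -/
def posInertia {ι : Type*} [Fintype ι] [DecidableEq ι] (H : Matrix ι ι ℂ)
    (hH : H.IsHermitian) : ℕ :=
  (Finset.univ.filter fun i => 0 < hH.eigenvalues i).card

/-- The number of negative eigenvalues, counted with multiplicity, of a Hermitian matrix. -/
def negInertia {ι : Type*} [Fintype ι] [DecidableEq ι] (H : Matrix ι ι ℂ)
    (hH : H.IsHermitian) : ℕ :=
  (Finset.univ.filter fun i => hH.eigenvalues i < 0).card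

variable {n p m q : ℕ}

/-- The quadratic matrix-valued function `φ(X) = (AXB + C) M (AXB + C)* + D`. -/
def phi (A : Matrix (Fin n) (Fin p) ℂ) (B : Matrix (Fin m) (Fin q) ℂ)
    (C : Matrix (Fin n) (Fin q) ℂ) (M : Matrix (Fin q) (Fin q) ℂ)
    (D : Matrix (Fin n) (Fin n) ℂ) (X : Matrix (Fin p) (Fin m) ℂ) :
    Matrix (Fin n) (Fin n) ℂ :=
  (A * X * B + C) * M * (A * X * B + C)ᴴ + D

/-- The block row `[D + CMC*, CMB*, A]`. -/
def N0 (A : Matrix (Fin n) (Fin p) ℂ) (B : Matrix (Fin m) (Fin q) ℂ)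
    (C : Matrix (Fin n) (Fin q) ℂ) (M : Matrix (Fin q) (Fin q) ℂ)
    (D : Matrix (Fin n) (Fin n) ℂ) :
    Matrix (Fin n) ((Fin n ⊕ Fin m) ⊕ Fin p) ℂ :=
  fromCols (fromCols (D + C * M * Cᴴ) (C * M * Bᴴ)) A

/-- `N₁ = [D + CMC*, A; A*, 0]`. -/
def N1 (A : Matrix (Fin n) (Fin p) ℂ) (C : Matrix (Fin n) (Fin q) ℂ)
    (M : Matrix (Fin q) (Fin q) ℂ) (D : Matrix (Fin n) (Fin n) ℂ) :
    Matrix (Fin n ⊕ Fin p) (Fin n ⊕ Fin p) ℂ :=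
  fromBlocks (D + C * M * Cᴴ) A Aᴴ 0

/-- `N₂ = [D + CMC*, CMB*, A; A*, 0, 0]`. -/
def N2 (A : Matrix (Fin n) (Fin p) ℂ) (B : Matrix (Fin m) (Fin q) ℂ)
    (C : Matrix (Fin n) (Fin q) ℂ) (M : Matrix (Fin q) (Fin q) ℂ)
    (D : Matrix (Fin n) (Fin n) ℂ) :
    Matrix (Fin n ⊕ Fin p) ((Fin n ⊕ Fin m) ⊕ Fin p) ℂ :=
  fromRows
    (fromCols (fromCols (D + C * M * Cᴴ) (C * M * Bᴴ)) A)
    (fromCols (fromCols Aᴴ 0) 0)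

/-- `N₃ = [D + CMC*, CMB*; BMC*, BMB*]`. -/
def N3 (B : Matrix (Fin m) (Fin q) ℂ) (C : Matrix (Fin n) (Fin q) ℂ)
    (M : Matrix (Fin q) (Fin q) ℂ) (D : Matrix (Fin n) (Fin n) ℂ) :
    Matrix (Fin n ⊕ Fin m) (Fin n ⊕ Fin m) ℂ :=
  fromBlocks (D + C * M * Cᴴ) (C * M * Bᴴ) (B * M * Cᴴ) (B * M * Bᴴ)

/-- `N₄ = [D + CMC*, CMB*, A; BMC*, BMB*, 0]`. -/
def N4 (A : Matrix (Fin n) (Fin p) ℂ) (B : Matrix (Fin m) (Fin q) ℂ)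
    (C : Matrix (Fin n) (Fin q) ℂ) (M : Matrix (Fin q) (Fin q) ℂ)
    (D : Matrix (Fin n) (Fin n) ℂ) :
    Matrix (Fin n ⊕ Fin m) ((Fin n ⊕ Fin m) ⊕ Fin p) ℂ :=
  fromRows
    (fromCols (fromCols (D + C * M * Cᴴ) (C * M * Bᴴ)) A)
    (fromCols (fromCols (B * M * Cᴴ) (B * M * Bᴴ)) 0)

theorem phi_isHermitian (A : Matrix (Fin n) (Fin p) ℂ) (B : Matrix (Fin m) (Fin q) ℂ)
    (C : Matrix (Fin n) (Fin q) ℂ) {M : Matrix (Fin q) (Fin q) ℂ}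
    {D : Matrix (Fin n) (Fin n) ℂ} (hM : M.IsHermitian) (hD : D.IsHermitian)
    (X : Matrix (Fin p) (Fin m) ℂ) : (phi A B C M D X).IsHermitian :=
  (isHermitian_mul_mul_conjTranspose _ hM).add hD

theorem N1_isHermitian (A : Matrix (Fin n) (Fin p) ℂ) (C : Matrix (Fin n) (Fin q) ℂ)
    {M : Matrix (Fin q) (Fin q) ℂ} {D : Matrix (Fin n) (Fin n) ℂ}
    (hM : M.IsHermitian) (hD : D.IsHermitian) : (N1 A C M D).IsHermitian :=
  (hD.add (isHermitian_mul_mul_conjTranspose _ hM)).fromBlocks rfl isHermitian_zero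

theorem N3_isHermitian (B : Matrix (Fin m) (Fin q) ℂ) (C : Matrix (Fin n) (Fin q) ℂ)
    {M : Matrix (Fin q) (Fin q) ℂ} {D : Matrix (Fin n) (Fin n) ℂ}
    (hM : M.IsHermitian) (hD : D.IsHermitian) : (N3 B C M D).IsHermitian :=
  (hD.add (isHermitian_mul_mul_conjTranspose _ hM)).fromBlocks
    (by rw [conjTranspose_mul, conjTranspose_mul, conjTranspose_conjTranspose, hM.eq,
      Matrix.mul_assoc])
    (isHermitian_mul_mul_conjTranspose _ hM)

end

end QuadInertia

/-! Let `T` be the Hermitian form of `N₃` on `E = ℂⁿ ⊕ ℂᵐ`, and put `J = [1; (AX)*]`. Then `φ(X) =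
J* N₃ J`, so the inertia of `φ(X)` is that of `T` restricted to the graph of `(AX)*`. As `X` varies,
these graphs are exactly the complements `W` of `U = 0 ⊕ ℂᵐ` that contain `K = ker A* ⊕ 0`
(`ker_le_graph`, `exists_eq_graph`). The theorem thus becomes a question about one form: which
inertias does `T` have on complements of `U` containing `K`?

Write `⊥` for orthogonality with respect to `T` and `rad = E^⊥`. The bounds valid for every `W` are
dimension counts. The main tool is `posIndex_decomposition`, which compares `i₊(W)` with `i₊(K)` and
`i₊(K^⊥ ∩ W)`. The positive index is at least both `i₊(K) + dim(K ∩ (K+U)^⊥) - dim(K ∩ rad)` and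
`i₊(E) - dim U + dim(rad ∩ (K+U)) - dim(K ∩ rad)`.

The bounds are attained by a greedy construction: `K` is enlarged one vector at a time, never
worsening the bound computed from the current `K`, until it is a complement of `U`, where its
inertia meets the bound (`exists_isCompl_of_step`). For the minima a single vector can be chosen
good for `T` and `-T` at once (`exists_minPosIndex_step`), so one `W` minimizes `i₊` and `i₋`
together. The minimal rank is therefore the sum of the two minima, and `s₁, …, s₄` are the four sums
of their entries. The maxima of `i₊` and `i₋` need not occur together, so the maximal rank has its
own bound and construction.

The dimensions are then read off from the block matrices: `i±(N₁) = r(A) + i±(K)`, `r₀ = n - dim(K ∩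
rad)`, `r(N₂) = n + r(A) - dim(K ∩ (K+U)^⊥)` and `r(N₄) = n + m - dim(rad ∩ (K+U))`. -/

namespace QuadInertia

open Module

/-! ### Hermitian forms on subspaces: index, Sylvester's law, orthogonal decomposition -/

section Form

variable {E : Type*} [NormedAddCommGroup E] [InnerProductSpace ℂ E]

/-- The quadratic form `x ↦ ⟨x, T x⟩` of a linear operator. -/
noncomputable def quadForm (T : E →ₗ[ℂ] E) (x : E) : ℝ := (inner ℂ (T x) x).re

/-- The orthogonal complement of `W` with respect to the form `⟨T x, y⟩`. -/
noncomputable def formPerp (T : E →ₗ[ℂ] E) (W : Submodule ℂ E) : Submodule ℂ E := (W.map T)ᗮ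

/-- The form of `T` is positive definite on `S`. -/
def PosDefOn (T : E →ₗ[ℂ] E) (S : Submodule ℂ E) : Prop := ∀ x ∈ S, x ≠ 0 → 0 < quadForm T x

/-- The form of `T` is negative semidefinite on `S`. -/
def NonposOn (T : E →ₗ[ℂ] E) (S : Submodule ℂ E) : Prop := ∀ x ∈ S, quadForm T x ≤ 0

/-- The largest dimension of a subspace of `W` on which the form of `T` is positive definite. -/
noncomputable def posIndex (T : E →ₗ[ℂ] E) (W : Submodule ℂ E) : ℕ :=
  sSup {d | ∃ S ≤ W, PosDefOn T S ∧ finrank ℂ S = d}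

variable {T : E →ₗ[ℂ] E} {K W S U : Submodule ℂ E} {x y v : E}

theorem mem_formPerp : y ∈ formPerp T W ↔ ∀ w ∈ W, inner ℂ (T w) y = 0 := by
  simp [formPerp, Submodule.mem_orthogonal]

theorem formPerp_neg : formPerp (-T) W = formPerp T W := by
  ext y; simp [mem_formPerp]

@[simp] theorem quadForm_neg : quadForm (-T) x = - quadForm T x := by
  simp [quadForm]

@[simp] theorem quadForm_zero : quadForm T 0 = 0 := by simp [quadForm]

theorem quadForm_smul (a : ℂ) : quadForm T (a • x) = Complex.normSq a * quadForm T x := by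
  rw [quadForm, map_smul, inner_smul_left, inner_smul_right, ← mul_assoc,
    ← Complex.normSq_eq_conj_mul_self, Complex.re_ofReal_mul, quadForm]

theorem inner_comm_zero (hT : T.IsSymmetric) : inner ℂ (T x) y = 0 ↔ inner ℂ (T y) x = 0 := by
  rw [hT x y, inner_eq_zero_symm]

theorem quadForm_add (hT : T.IsSymmetric) :
    quadForm T (x + y) = quadForm T x + 2 * (inner ℂ (T x) y).re + quadForm T y := by
  have h : (inner ℂ (T y) x).re = (inner ℂ (T x) y).re := by
    rw [hT y x, ← inner_conj_symm, Complex.conj_re]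
  simp only [quadForm, map_add, inner_add_left, inner_add_right, Complex.add_re, h]
  ring

theorem quadForm_add_of_orthogonal (hT : T.IsSymmetric) (h : inner ℂ (T x) y = 0) :
    quadForm T (x + y) = quadForm T x + quadForm T y := by
  rw [quadForm_add hT, h]; simp

theorem isSymmetric_neg (hT : T.IsSymmetric) : (-T).IsSymmetric := fun x y => by
  simp [hT x y]

theorem formPerp_anti (h : K ≤ W) : formPerp T W ≤ formPerp T K :=
  fun _ hy => mem_formPerp.2 fun w hw => mem_formPerp.1 hy w (h hw)

theorem le_formPerp_comm (hT : T.IsSymmetric) : K ≤ formPerp T W ↔ W ≤ formPerp T K := by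
  constructor <;> intro h x hx <;> refine mem_formPerp.2 fun w hw => ?_ <;>
    exact (inner_comm_zero hT).1 (mem_formPerp.1 (h hw) x hx)

theorem formPerp_sup : formPerp T (K ⊔ W) = formPerp T K ⊓ formPerp T W := by
  simp [formPerp, Submodule.map_sup, Submodule.inf_orthogonal]

theorem quadForm_eq_zero_of_mem_formPerp (h : x ∈ formPerp T W) (hx : x ∈ W) :
    quadForm T x = 0 := by
  simp [quadForm, mem_formPerp.1 h x hx]

theorem NonposOn.sup (hT : T.IsSymmetric) (hK : NonposOn T K) (hW : NonposOn T W)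
    (h : W ≤ formPerp T K) : NonposOn T (K ⊔ W) := by
  intro x hx
  obtain ⟨a, ha, b, hb, rfl⟩ := Submodule.mem_sup.1 hx
  rw [quadForm_add_of_orthogonal hT (mem_formPerp.1 (h hb) a ha)]
  exact add_nonpos (hK a ha) (hW b hb)

theorem PosDefOn.sup (hT : T.IsSymmetric) (hK : PosDefOn T K) (hW : PosDefOn T W)
    (h : W ≤ formPerp T K) : PosDefOn T (K ⊔ W) := by
  intro x hx h0
  obtain ⟨a, ha, b, hb, rfl⟩ := Submodule.mem_sup.1 hx
  rw [quadForm_add_of_orthogonal hT (mem_formPerp.1 (h hb) a ha)]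
  by_cases ha0 : a = 0
  · subst ha0
    simpa using hW b hb (by simpa using h0)
  · by_cases hb0 : b = 0
    · subst hb0
      simpa using hK a ha ha0
    · exact add_pos (hK a ha ha0) (hW b hb hb0)

theorem PosDefOn.nonposOn_neg (hK : PosDefOn T K) : NonposOn (-T) K := by
  intro x hx
  by_cases h : x = 0
  · simp [h]
  · simpa using (hK x hx h).le

theorem PosDefOn.mono (hW : PosDefOn T W) (h : K ≤ W) : PosDefOn T K :=
  fun x hx => hW x (h hx)

theorem NonposOn.mono (hW : NonposOn T W) (h : K ≤ W) : NonposOn T K :=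
  fun x hx => hW x (h hx)

theorem PosDefOn.inf_formPerp (hK : PosDefOn T K) : K ⊓ formPerp T K = ⊥ := by
  rw [Submodule.eq_bot_iff]
  intro x hx
  by_contra h0
  exact (hK x hx.1 h0).ne' (quadForm_eq_zero_of_mem_formPerp hx.2 hx.1)

theorem PosDefOn.inf_eq_bot (hK : PosDefOn T K) (hW : NonposOn T W) : K ⊓ W = ⊥ := by
  rw [Submodule.eq_bot_iff]
  intro x hx
  by_contra h
  exact absurd (hK x hx.1 h) (not_lt.2 (hW x hx.2))

theorem posDefOn_span_singleton (h : 0 < quadForm T v) : PosDefOn T (ℂ ∙ v) := by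
  intro x hx h0
  obtain ⟨a, rfl⟩ := Submodule.mem_span_singleton.1 hx
  rw [quadForm_smul]
  exact mul_pos (Complex.normSq_pos.2 (by rintro rfl; simp at h0)) h

theorem nonposOn_span_singleton (h : quadForm T v ≤ 0) : NonposOn T (ℂ ∙ v) := by
  intro x hx
  obtain ⟨a, rfl⟩ := Submodule.mem_span_singleton.1 hx
  rw [quadForm_smul]
  exact mul_nonpos_of_nonneg_of_nonpos (Complex.normSq_nonneg _) h

theorem span_singleton_le_formPerp (h : v ∈ formPerp T W) : (ℂ ∙ v) ≤ formPerp T W :=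
  (Submodule.span_singleton_le_iff_mem _ _).2 h

/-- Polarization: a form vanishing on the diagonal of `W` vanishes on all pairs. -/
theorem le_formPerp_self (hT : T.IsSymmetric) (h : ∀ x ∈ W, quadForm T x = 0) :
    W ≤ formPerp T W := by
  have key : ∀ x ∈ W, ∀ y ∈ W, (inner ℂ (T x) y).re = 0 := fun x hx y hy => by
    have := quadForm_add hT (x := x) (y := y)
    rw [h x hx, h y hy, h _ (W.add_mem hx hy)] at this
    linarith
  intro y hy
  refine mem_formPerp.2 fun x hx => Complex.ext (key x hx y hy) ?_
  -- Replacing `y` by `i y` turns the statement on real parts into one on imaginary parts.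
  have := key x hx (Complex.I • y) (W.smul_mem _ hy)
  rw [inner_smul_right] at this
  simpa using this

variable [FiniteDimensional ℂ E]

theorem bddAbove_posDef (T : E →ₗ[ℂ] E) (W : Submodule ℂ E) :
    BddAbove {d | ∃ S ≤ W, PosDefOn T S ∧ finrank ℂ S = d} :=
  ⟨finrank ℂ E, by rintro d ⟨S, -, -, rfl⟩; exact S.finrank_le⟩

theorem PosDefOn.finrank_le_posIndex (h : PosDefOn T S) (hS : S ≤ W) :
    finrank ℂ S ≤ posIndex T W :=
  le_csSup (bddAbove_posDef T W) ⟨S, hS, h, rfl⟩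

theorem exists_posDefOn (T : E →ₗ[ℂ] E) (W : Submodule ℂ E) :
    ∃ S ≤ W, PosDefOn T S ∧ finrank ℂ S = posIndex T W :=
  Nat.sSup_mem (s := {d | ∃ S ≤ W, PosDefOn T S ∧ finrank ℂ S = d})
    ⟨0, ⊥, bot_le, by intro x hx h; exact absurd ((Submodule.mem_bot ℂ).1 hx) h, by simp⟩
    (bddAbove_posDef T W)

theorem posIndex_mono (h : K ≤ W) : posIndex T K ≤ posIndex T W := by
  obtain ⟨S, hS, hp, hd⟩ := exists_posDefOn T K
  exact hd ▸ hp.finrank_le_posIndex (hS.trans h)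

/-- A positive definite subspace meets `N` only in `0`, so inside `P + N` its dimension is at most
the codimension of `N`, hence at most `dim P`. -/
theorem posIndex_le_of_le_sup {P N : Submodule ℂ E} (h : W ≤ P ⊔ N) (hN : NonposOn T N) :
    posIndex T W ≤ finrank ℂ P := by
  obtain ⟨S, hS, hp, hd⟩ := exists_posDefOn T W
  have h1 := Submodule.finrank_sup_add_finrank_inf_eq S N
  have h2 := Submodule.finrank_sup_add_finrank_inf_eq P N
  have h3 := Submodule.finrank_mono (sup_le (hS.trans h) (le_sup_right) : S ⊔ N ≤ P ⊔ N)
  rw [hp.inf_eq_bot hN, finrank_bot] at h1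
  omega

/-- Intersecting a positive definite subspace of `W` with `K` costs at most the codimension of `K`
in `W`. -/
theorem posIndex_le_add (h : K ≤ W) :
    posIndex T W + finrank ℂ K ≤ posIndex T K + finrank ℂ W := by
  obtain ⟨S, hS, hp, hd⟩ := exists_posDefOn T W
  have h1 := Submodule.finrank_sup_add_finrank_inf_eq S K
  have h2 := (hp.mono (inf_le_left : S ⊓ K ≤ S)).finrank_le_posIndex inf_le_right
  have h3 := Submodule.finrank_mono (sup_le hS h)
  omega

/-- Rank-nullity for `K → W`, `x ↦ P_W (T x)`: the kernel is `K ∩ W^⊥`, and the orthogonal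
complement of the range in `W` is `K^⊥ ∩ W`. -/
theorem finrank_formPerp_inf (hT : T.IsSymmetric) (K W : Submodule ℂ E) :
    finrank ℂ ↥(formPerp T K ⊓ W) + finrank ℂ K = finrank ℂ W + finrank ℂ ↥(K ⊓ formPerp T W) := by
  set f : K →ₗ[ℂ] E := ((W.starProjection : E →ₗ[ℂ] E) ∘ₗ T).domRestrict K with hf
  have hr : f.range ≤ W := by
    rintro _ ⟨x, rfl⟩
    simp [hf]
  have h1 : f.rangeᗮ ⊓ W = formPerp T K ⊓ W := by
    ext y
    simp only [Submodule.mem_inf, Submodule.mem_orthogonal, mem_formPerp]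
    refine and_congr_left fun hy => ?_
    have key : ∀ x, inner ℂ (W.starProjection (T x)) y = inner ℂ (T x) y := fun x => by
      rw [Submodule.inner_starProjection_left_eq_right, Submodule.starProjection_eq_self_iff.2 hy]
    constructor
    · intro hx w hw
      rw [← key]
      exact hx _ ⟨⟨w, hw⟩, rfl⟩
    · rintro hx _ ⟨w, rfl⟩
      exact (key w).trans (hx w w.2)
  have h2 : f.ker.map K.subtype = K ⊓ formPerp T W := by
    ext x
    simp only [Submodule.mem_map, LinearMap.mem_ker, Submodule.mem_inf, mem_formPerp]
    have key : W.starProjection (T x) = 0 ↔ ∀ w ∈ W, inner ℂ (T w) x = 0 := by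
      rw [Submodule.starProjection_apply_eq_zero_iff, Submodule.mem_orthogonal]
      exact forall₂_congr fun w _ => by rw [← hT w x]
    constructor
    · rintro ⟨y, hy, rfl⟩
      exact ⟨y.2, key.1 hy⟩
    · rintro ⟨hx, hw⟩
      exact ⟨⟨x, hx⟩, key.2 hw, rfl⟩
  have h3 := Submodule.finrank_add_inf_finrank_orthogonal hr
  have h4 := f.finrank_range_add_finrank_ker
  rw [h1] at h3
  rw [← h2, Submodule.finrank_map_subtype_eq]
  omega

/-- Take `P` positive definite of maximal dimension. A positive vector in `P^⊥ ∩ W` could be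
adjoined to `P`, so there is none; and `P ∩ P^⊥ = 0` makes the sum fill `W` by dimension. -/
theorem exists_posDefOn_sup (hT : T.IsSymmetric) (W : Submodule ℂ E) :
    ∃ P ≤ W, PosDefOn T P ∧ finrank ℂ P = posIndex T W ∧ NonposOn T (formPerp T P ⊓ W) ∧
      P ⊔ (formPerp T P ⊓ W) = W := by
  obtain ⟨P, hP, hp, hd⟩ := exists_posDefOn T W
  have hdisj := hp.inf_formPerp
  refine ⟨P, hP, hp, hd, ?_, ?_⟩
  · intro v hv
    by_contra! hpos
    have h1 := (hp.sup hT (posDefOn_span_singleton hpos)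
      (span_singleton_le_formPerp hv.1)).finrank_le_posIndex (W := W)
      (sup_le hP ((Submodule.span_singleton_le_iff_mem _ _).2 hv.2))
    have h2 := Submodule.finrank_sup_add_finrank_inf_eq P (ℂ ∙ v)
    have h3 : P ⊓ (ℂ ∙ v) = ⊥ :=
      eq_bot_iff.2 (hdisj ▸ inf_le_inf_left _ (span_singleton_le_formPerp hv.1))
    have h4 : v ≠ 0 := by rintro rfl; simp at hpos
    rw [h3, finrank_bot, finrank_span_singleton h4] at h2
    omega
  · refine Submodule.eq_of_le_of_finrank_le (sup_le hP inf_le_right) ?_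
    have h1 := finrank_formPerp_inf hT P W
    have h2 := Submodule.finrank_sup_add_finrank_inf_eq P (formPerp T P ⊓ W)
    rw [← inf_assoc, hdisj, bot_inf_eq, finrank_bot] at h2
    omega

/-- Sylvester's law of inertia on a subspace. -/
theorem posIndex_add_negIndex (hT : T.IsSymmetric) (W : Submodule ℂ E) :
    posIndex T W + posIndex (-T) W + finrank ℂ ↥(W ⊓ formPerp T W) = finrank ℂ W := by
  obtain ⟨P, hP, hp, hd, hN, hs⟩ := exists_posDefOn_sup hT W
  set N := formPerp T P ⊓ W with hNdef
  obtain ⟨P', hP', hp', hd', hN', hs'⟩ := exists_posDefOn_sup (isSymmetric_neg hT) N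
  rw [formPerp_neg] at hN' hs'
  set Z := formPerp T P' ⊓ N with hZdef
  have hNP : N ≤ formPerp T P := inf_le_left
  -- `W = P ⊕ P' ⊕ Z` with `P` positive, `P'` negative. The form vanishes identically on `Z`, which
  -- is therefore the radical of `W`.
  have hZ0 : Z ≤ formPerp T Z := le_formPerp_self hT fun x hx =>
    le_antisymm (hN x hx.2) (by simpa using hN' x hx)
  have hZW : W ⊓ formPerp T W = Z := by
    apply le_antisymm
    · intro x hx
      have hPx := formPerp_anti hP hx.2
      exact ⟨formPerp_anti (hP'.trans inf_le_right) hx.2, hPx, hx.1⟩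
    · refine le_inf (inf_le_right.trans inf_le_right) ?_
      rw [← hs, ← hs', formPerp_sup, formPerp_sup]
      exact le_inf (inf_le_right.trans hNP) (le_inf inf_le_left hZ0)
  have h1 : posIndex (-T) W ≤ finrank ℂ P' := by
    refine posIndex_le_of_le_sup (N := P ⊔ Z) ?_ ?_
    · rw [sup_left_comm, hs', hs]
    · refine hp.nonposOn_neg.sup (isSymmetric_neg hT) hN' ?_
      rw [formPerp_neg]
      exact inf_le_right.trans hNP
  have h2 := hp'.finrank_le_posIndex (hP'.trans inf_le_right : P' ≤ W)
  have h3 := Submodule.finrank_sup_add_finrank_inf_eq P N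
  have h4 := Submodule.finrank_sup_add_finrank_inf_eq P' Z
  rw [hp.inf_eq_bot hN, finrank_bot, hs] at h3
  rw [hp'.inf_eq_bot hN', finrank_bot, hs'] at h4
  rw [hZW]
  omega

theorem posIndex_sup_le (hT : T.IsSymmetric) (h : W ≤ formPerp T K) :
    posIndex T (K ⊔ W) ≤ posIndex T K + posIndex T W := by
  obtain ⟨P, hP, -, hd, hN, hs⟩ := exists_posDefOn_sup hT K
  obtain ⟨P', hP', -, hd', hN', hs'⟩ := exists_posDefOn_sup hT W
  have := posIndex_le_of_le_sup (T := T) (W := K ⊔ W) (P := P ⊔ P')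
    (N := (formPerp T P ⊓ K) ⊔ (formPerp T P' ⊓ W)) (by rw [sup_sup_sup_comm, hs, hs'])
    (hN.sup hT hN' (inf_le_right.trans (h.trans (formPerp_anti inf_le_right))))
  have h2 := Submodule.finrank_add_le_finrank_add_finrank P P'
  omega

theorem posIndex_eq_zero (h : NonposOn T W) : posIndex T W = 0 := by
  have := posIndex_le_of_le_sup (T := T) (W := W) (P := ⊥) (by simp) h
  simpa using this

theorem exists_pos_of_posIndex (h : 0 < posIndex T W) : ∃ x ∈ W, 0 < quadForm T x := by
  by_contra! h'
  rw [posIndex_eq_zero h'] at h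
  exact lt_irrefl _ h

theorem posIndex_sup_of_orthogonal_nonpos (hT : T.IsSymmetric) (h : W ≤ formPerp T K)
    (hW : NonposOn T W) : posIndex T (K ⊔ W) = posIndex T K := by
  have := posIndex_sup_le hT h
  rw [posIndex_eq_zero hW] at this
  exact le_antisymm this (posIndex_mono le_sup_left)

theorem finrank_sup_formPerp (hT : T.IsSymmetric) (h : K ≤ W) :
    finrank ℂ ↥(K ⊔ (formPerp T K ⊓ W)) + finrank ℂ ↥(K ⊓ formPerp T K) =
      finrank ℂ W + finrank ℂ ↥(K ⊓ formPerp T W) := by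
  have h1 := Submodule.finrank_sup_add_finrank_inf_eq K (formPerp T K ⊓ W)
  have h2 := finrank_formPerp_inf hT K W
  have h3 : K ⊓ (formPerp T K ⊓ W) = K ⊓ formPerp T K := by
    rw [← inf_assoc, inf_right_comm, inf_eq_left.2 h]
  rw [h3] at h1
  omega

/-- Pass from `W` to `K + (K^⊥ ∩ W)`, whose codimension in `W` is `dim(K ∩ K^⊥) - dim(K ∩ W^⊥)`, and
split the index of this orthogonal sum. -/
theorem posIndex_le_decomposition (hT : T.IsSymmetric) (h : K ≤ W) :
    posIndex T W + finrank ℂ ↥(K ⊓ formPerp T W) ≤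
      posIndex T K + posIndex T (formPerp T K ⊓ W) + finrank ℂ ↥(K ⊓ formPerp T K) := by
  have h1 := posIndex_sup_le hT (K := K) (W := formPerp T K ⊓ W) inf_le_left
  have h2 := posIndex_le_add (T := T) (sup_le h inf_le_right : K ⊔ (formPerp T K ⊓ W) ≤ W)
  have h3 := finrank_sup_formPerp hT h
  omega

/-- Inertia of a form on `W` in terms of a subspace `K` of `W` and its orthogonal complement. -/
theorem posIndex_decomposition (hT : T.IsSymmetric) (h : K ≤ W) :
    posIndex T W + finrank ℂ ↥(K ⊓ formPerp T W) =
      posIndex T K + posIndex T (formPerp T K ⊓ W) + finrank ℂ ↥(K ⊓ formPerp T K) := by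
  refine le_antisymm (posIndex_le_decomposition hT h) ?_
  -- The inequality also holds for `-T`. By Sylvester's law the sum of the two is already an
  -- equality, so neither can be strict.
  have h1 := posIndex_le_decomposition (isSymmetric_neg hT) h
  rw [formPerp_neg, formPerp_neg] at h1
  have h2 := posIndex_add_negIndex hT W
  have h3 := posIndex_add_negIndex hT K
  have h4 := posIndex_add_negIndex hT (formPerp T K ⊓ W)
  have h5 := finrank_formPerp_inf hT K W
  -- Both the radical of `K` and that of `W` lie in the radical of `K^⊥ ∩ W`. This bounds the rank
  -- on `K^⊥ ∩ W` from above.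
  have h6 : (K ⊓ formPerp T K) ⊔ (W ⊓ formPerp T W) ≤
      (formPerp T K ⊓ W) ⊓ formPerp T (formPerp T K ⊓ W) := by
    refine sup_le (le_inf ?_ ?_) (le_inf ?_ ?_)
    · exact le_inf inf_le_right (inf_le_left.trans h)
    · exact inf_le_left.trans ((le_formPerp_comm hT).2 inf_le_left)
    · exact le_inf (inf_le_right.trans (formPerp_anti h)) inf_le_left
    · exact inf_le_right.trans (formPerp_anti inf_le_right)
  have h7 := Submodule.finrank_mono h6
  have h8 := Submodule.finrank_sup_add_finrank_inf_eq (K ⊓ formPerp T K) (W ⊓ formPerp T W)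
  have h9 : (K ⊓ formPerp T K) ⊓ (W ⊓ formPerp T W) = K ⊓ formPerp T W := by
    apply le_antisymm
    · exact le_inf (inf_le_left.trans inf_le_left) (inf_le_right.trans inf_le_right)
    · exact le_inf (inf_le_inf_left _ (formPerp_anti h)) (inf_le_inf_right _ h)
  rw [h9] at h8
  omega

end Form

/-! ### Vectors of prescribed sign outside given subspaces, and one-step extensions -/

section Extension

variable {E : Type*} [NormedAddCommGroup E] [InnerProductSpace ℂ E]
variable {T : E →ₗ[ℂ] E} {K W S U : Submodule ℂ E} {x y v : E}

theorem quadForm_add_smul (hT : T.IsSymmetric) (t : ℝ) :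
    quadForm T (x + (t : ℂ) • y) =
      quadForm T x + 2 * t * (inner ℂ (T x) y).re + t ^ 2 * quadForm T y := by
  rw [quadForm_add hT, quadForm_smul, inner_smul_right, Complex.re_ofReal_mul,
    Complex.normSq_ofReal]
  ring

theorem exists_pos_notMem (hT : T.IsSymmetric) (hWS : ¬ W ≤ S) (hx : x ∈ W)
    (hpos : 0 < quadForm T x) : ∃ v ∈ W, v ∉ S ∧ 0 < quadForm T v := by
  by_cases hxS : x ∈ S
  · obtain ⟨y, hyW, hyS⟩ := Set.not_subset.1 hWS
    set b := 2 * (inner ℂ (T y) x).re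
    -- The vector will be `y + t x` with `y` outside `S`; this `t` makes the term `t² ⟨Tx, x⟩`
    -- dominate the linear and constant ones.
    set t := max 1 ((|b| + |quadForm T y| + 1) / quadForm T x)
    have ht1 : 1 ≤ t := le_max_left _ _
    have ht2 : |b| + |quadForm T y| + 1 ≤ t * quadForm T x :=
      (div_le_iff₀ hpos).1 (le_max_right _ _)
    refine ⟨y + (t : ℂ) • x, W.add_mem hyW (W.smul_mem _ hx), fun h => hyS ?_, ?_⟩
    · exact (S.add_mem_iff_left (S.smul_mem _ hxS)).1 h
    · rw [quadForm_add_smul hT]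
      have h1 : t * (|b| + |quadForm T y| + 1) ≤ t * (t * quadForm T x) := by gcongr
      have h2 : -(t * |b|) ≤ t * b := by
        rw [← mul_neg]; gcongr; exact neg_abs_le b
      have h3 : |quadForm T y| ≤ t * |quadForm T y| :=
        le_mul_of_one_le_left (abs_nonneg _) ht1
      have h4 := neg_abs_le (quadForm T y)
      have h5 : 2 * t * (inner ℂ (T y) x).re = t * b := by simp only [b]; ring
      rw [h5]
      nlinarith
  · exact ⟨x, hx, hxS, hpos⟩

/-- The leading and constant coefficients have opposite signs, so the roots are real, one of them
positive. -/
theorem exists_root_of_neg {a b c : ℝ} (ha : 0 < a) (hc : c < 0) :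
    ∃ t > 0, a + b * t + c * t ^ 2 = 0 := by
  have hd : b ^ 2 < b ^ 2 - 4 * a * c := by nlinarith
  have hs := Real.sq_sqrt ((sq_nonneg b).trans hd.le)
  have hb : |b| < √(b ^ 2 - 4 * a * c) := by
    rw [← Real.sqrt_sq_eq_abs]; exact Real.sqrt_lt_sqrt (sq_nonneg b) hd
  refine ⟨(-b - √(b ^ 2 - 4 * a * c)) / (2 * c), ?_, ?_⟩
  · exact div_pos_of_neg_of_neg (by linarith [neg_abs_le b]) (by linarith)
  · have := hc.ne
    generalize √(b ^ 2 - 4 * a * c) = s at hs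
    field_simp
    linear_combination hs

/-- The line `y + ℝ x` carries isotropic vectors `y + s x` and `y - t x` with `s, t > 0`. A positive
multiple of `y` is a combination of them, so `S` cannot contain both. -/
theorem exists_isotropic_of_pos (hT : T.IsSymmetric) (hy : y ∈ W) (hyS : y ∉ S) (hx : x ∈ W)
    (hypos : 0 < quadForm T y) (hneg : quadForm T x < 0) :
    ∃ v ∈ W, v ∉ S ∧ quadForm T v = 0 := by
  obtain ⟨s, hs, hs0⟩ := exists_root_of_neg (b := 2 * (inner ℂ (T y) x).re) hypos hneg
  obtain ⟨t, ht, ht0⟩ := exists_root_of_neg (b := - (2 * (inner ℂ (T y) x).re)) hypos hneg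
  by_contra! h
  have h1 : y + (s : ℂ) • x ∈ S := by
    by_contra h'
    refine h _ (W.add_mem hy (W.smul_mem _ hx)) h' ?_
    rw [quadForm_add_smul hT, ← hs0]; ring
  have h2 : y + ((-t : ℝ) : ℂ) • x ∈ S := by
    by_contra h'
    refine h _ (W.add_mem hy (W.smul_mem _ hx)) h' ?_
    rw [quadForm_add_smul hT, ← ht0]; ring
  have h3 : ((s + t : ℝ) : ℂ) • y =
      (t : ℂ) • (y + (s : ℂ) • x) + (s : ℂ) • (y + ((-t : ℝ) : ℂ) • x) := by
    push_cast
    module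
  have h4 : ((s + t : ℝ) : ℂ) • y ∈ S :=
    h3 ▸ S.add_mem (S.smul_mem _ h1) (S.smul_mem _ h2)
  refine hyS ((S.smul_mem_iff ?_).1 h4)
  exact_mod_cast (add_pos hs ht).ne'

theorem exists_isotropic_notMem (hT : T.IsSymmetric) (hWS : ¬ W ≤ S) (hx : x ∈ W)
    (hpos : 0 < quadForm T x) (hy : y ∈ W) (hneg : quadForm T y < 0) :
    ∃ v ∈ W, v ∉ S ∧ quadForm T v = 0 := by
  obtain ⟨w, hw, hwS⟩ := Set.not_subset.1 hWS
  rcases lt_trichotomy (quadForm T w) 0 with h | h | h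
  · obtain ⟨v, hv, hvS, h0⟩ := exists_isotropic_of_pos (isSymmetric_neg hT) hw hwS hx
      (by simpa using h) (by simpa using hpos)
    exact ⟨v, hv, hvS, by simpa using h0⟩
  · exact ⟨w, hw, hwS, h⟩
  · exact exists_isotropic_of_pos hT hw hwS hy h hneg

/-- In an indefinite space `W`, some isotropic vector avoids two proper orthogonal subspaces. -/
theorem exists_isotropic_notMem_notMem (hT : T.IsSymmetric) {S' : Submodule ℂ E}
    (hWS : ¬ W ≤ S) (hWS' : ¬ W ≤ S') (horth : ∀ a ∈ W ⊓ S, ∀ b ∈ W ⊓ S', inner ℂ (T a) b = 0)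
    (hx : x ∈ W) (hpos : 0 < quadForm T x) (hy : y ∈ W) (hneg : quadForm T y < 0) :
    ∃ v ∈ W, v ∉ S ∧ v ∉ S' ∧ quadForm T v = 0 := by
  obtain ⟨v, hv, hvS, hv0⟩ := exists_isotropic_notMem hT hWS hx hpos hy hneg
  obtain ⟨w, hw, hwS, hw0⟩ := exists_isotropic_notMem hT hWS' hx hpos hy hneg
  by_cases hv' : v ∈ S'
  · by_cases hw' : w ∈ S
    -- Here `v ∈ S' \ S` and `w ∈ S \ S'` are isotropic and mutually orthogonal, so `w + v` is
    -- isotropic and avoids both subspaces.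
    · refine ⟨w + v, W.add_mem hw hv, ?_, ?_, ?_⟩
      · rwa [S.add_mem_iff_right hw']
      · rwa [S'.add_mem_iff_left hv']
      · rw [quadForm_add_of_orthogonal hT (horth w ⟨hw, hw'⟩ v ⟨hv, hv'⟩), hv0, hw0, add_zero]
    · exact ⟨w, hw, hw', hwS, hw0⟩
  · exact ⟨v, hv, hvS, hv', hv0⟩

/-- A vector of `K + ℂ v` which is orthogonal to a vector not orthogonal to `v` lies in `K`. -/
theorem mem_of_mem_sup_span (hx : ∀ k ∈ K, inner ℂ (T x) k = 0) (hv : inner ℂ (T x) v ≠ 0)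
    (hy : y ∈ K ⊔ ℂ ∙ v) (hxy : inner ℂ (T x) y = 0) : y ∈ K := by
  obtain ⟨k, hk, w, hw, rfl⟩ := Submodule.mem_sup.1 hy
  obtain ⟨a, rfl⟩ := Submodule.mem_span_singleton.1 hw
  rw [inner_add_right, hx k hk, zero_add, inner_smul_right] at hxy
  rw [(mul_eq_zero.1 hxy).resolve_right hv]
  simpa using hk

theorem exists_notMem_notMem {S' : Submodule ℂ E} (hS : S ≠ ⊤) (hS' : S' ≠ ⊤) :
    ∃ v, v ∉ S ∧ v ∉ S' := by
  obtain ⟨a, -, ha⟩ := SetLike.exists_of_lt hS.lt_top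
  obtain ⟨b, -, hb⟩ := SetLike.exists_of_lt hS'.lt_top
  by_cases ha' : a ∈ S'
  · by_cases hb' : b ∈ S
    · refine ⟨a + b, ?_, ?_⟩
      · rwa [S.add_mem_iff_left hb']
      · rwa [S'.add_mem_iff_right ha']
    · exact ⟨b, hb', hb⟩
  · exact ⟨a, ha, ha'⟩

theorem sup_span_inf_eq_bot (h : K ⊓ U = ⊥) (hv : v ∉ K ⊔ U) : (K ⊔ ℂ ∙ v) ⊓ U = ⊥ := by
  rw [Submodule.eq_bot_iff]
  rintro x ⟨hx, hxU⟩
  obtain ⟨k, hk, w, hw, rfl⟩ := Submodule.mem_sup.1 hx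
  obtain ⟨a, rfl⟩ := Submodule.mem_span_singleton.1 hw
  have ha : a = 0 := by
    by_contra ha
    refine hv (((K ⊔ U).smul_mem_iff ha).1 ?_)
    exact ((K ⊔ U).add_mem_iff_right (Submodule.mem_sup_left hk)).1 (Submodule.mem_sup_right hxU)
  subst ha
  have : k + (0 : ℂ) • v ∈ K ⊓ U := ⟨by simpa using hk, hxU⟩
  rwa [h, Submodule.mem_bot] at this

variable [FiniteDimensional ℂ E]

theorem finrank_sup_span (hv : v ∉ K) : finrank ℂ ↥(K ⊔ ℂ ∙ v) = finrank ℂ K + 1 := by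
  have h0 : v ≠ 0 := by rintro rfl; exact hv K.zero_mem
  have h1 := Submodule.finrank_sup_add_finrank_inf_eq K (ℂ ∙ v)
  have h2 : K ⊓ (ℂ ∙ v) = ⊥ := by
    rw [inf_comm]
    exact (Submodule.disjoint_span_singleton' h0).2 hv |>.symm.eq_bot
  rw [h2, finrank_bot, finrank_span_singleton h0] at h1
  omega

theorem posIndex_sup_span_le (hv : v ∉ K) : posIndex T (K ⊔ ℂ ∙ v) ≤ posIndex T K + 1 := by
  have h1 := posIndex_le_add (T := T) (le_sup_left : K ≤ K ⊔ ℂ ∙ v)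
  have h2 := finrank_sup_span hv
  omega

/-- If every subspace `K` with `K ∩ U = 0`, `K + U ≠ E` has a one-dimensional extension
independent of `U` and compatible with a relation `r`, then `K` extends to a complement of `U`. -/
theorem exists_isCompl_of_step (r : Submodule ℂ E → Submodule ℂ E → Prop) (hr : ∀ K, r K K)
    (htrans : ∀ K₁ K₂ K₃, r K₁ K₂ → r K₂ K₃ → r K₁ K₃)
    (hstep : ∀ K, K ⊓ U = ⊥ → K ⊔ U ≠ ⊤ → ∃ v ∉ K ⊔ U, r K (K ⊔ ℂ ∙ v)) (hK : K ⊓ U = ⊥) :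
    ∃ W, K ≤ W ∧ W ⊓ U = ⊥ ∧ W ⊔ U = ⊤ ∧ r K W := by
  induction hc : finrank ℂ E - finrank ℂ K using Nat.strong_induction_on generalizing K with
  | _ c ih =>
    by_cases htop : K ⊔ U = ⊤
    · exact ⟨K, le_rfl, hK, htop, hr K⟩
    · obtain ⟨v, hv, hrv⟩ := hstep K hK htop
      have hvK : v ∉ K := fun h => hv (Submodule.mem_sup_left h)
      have h1 := finrank_sup_span hvK
      have h2 := Submodule.finrank_le (K ⊔ ℂ ∙ v)
      obtain ⟨W, hKW, hW1, hW2, hW⟩ := ih _ (by omega) (sup_span_inf_eq_bot hK hv) rfl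
      exact ⟨W, le_sup_left.trans hKW, hW1, hW2, htrans _ _ _ hrv hW⟩

end Extension

/-! ### Simultaneous minimization of both inertias -/

section Extremal

variable {E : Type*} [NormedAddCommGroup E] [InnerProductSpace ℂ E]
variable {T : E →ₗ[ℂ] E} {K W S U : Submodule ℂ E} {x y v : E}

/-- The smallest positive inertia of the form of `T` on complements of `U` containing `K`. -/
noncomputable def minPosIndex (T : E →ₗ[ℂ] E) (U K : Submodule ℂ E) : ℤ :=
  max (posIndex T K + finrank ℂ ↥(K ⊓ formPerp T (K ⊔ U)) - finrank ℂ ↥(K ⊓ formPerp T ⊤))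
    (posIndex T ⊤ - finrank ℂ U + finrank ℂ ↥(formPerp T ⊤ ⊓ (K ⊔ U)) -
      finrank ℂ ↥(K ⊓ formPerp T ⊤))

theorem mem_sup_span_orthogonal (hT : T.IsSymmetric) (hv : v ∈ formPerp T K) (hy : y ∈ K ⊔ ℂ ∙ v)
    (hyv : inner ℂ (T v) y = 0) (hvv : quadForm T v ≠ 0) : y ∈ K :=
  mem_of_mem_sup_span (x := v) (fun k hk => (inner_comm_zero hT).1 (mem_formPerp.1 hv k hk))
    (fun h => hvv (by simp [quadForm, h])) hy hyv

/-- When `K + U = E`, the two correction terms in the first entry cancel. This closes the greedy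
construction. -/
theorem posIndex_le_minPosIndex (htop : K ⊔ U = ⊤) : (posIndex T K : ℤ) ≤ minPosIndex T U K := by
  refine le_trans ?_ (le_max_left _ _)
  rw [htop]
  omega

variable [FiniteDimensional ℂ E]

theorem minPosIndex_le (hT : T.IsSymmetric) (hKW : K ≤ W) (hWU : W ⊓ U = ⊥)
    (htop : W ⊔ U = ⊤) : minPosIndex T U K ≤ posIndex T W := by
  have hk := Submodule.finrank_add_le_finrank_add_finrank K U
  have hw := Submodule.finrank_sup_add_finrank_inf_eq W U
  rw [hWU, htop, finrank_bot, finrank_top] at hw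
  refine max_le ?_ ?_
  · have h1 := posIndex_decomposition hT hKW
    -- Both `K ∩ (K+U)^⊥` and `K ∩ W^⊥` sit in `K ∩ K^⊥`, and they meet inside the radical since `W
    -- + U = E`. This bounds `dim(K ∩ K^⊥)` from below in the decomposition formula.
    have h2 := Submodule.finrank_sup_add_finrank_inf_eq (K ⊓ formPerp T (K ⊔ U)) (K ⊓ formPerp T W)
    have h3 : (K ⊓ formPerp T (K ⊔ U)) ⊔ (K ⊓ formPerp T W) ≤ K ⊓ formPerp T K :=
      sup_le (inf_le_inf_left _ (formPerp_anti le_sup_left)) (inf_le_inf_left _ (formPerp_anti hKW))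
    have h4 : (K ⊓ formPerp T (K ⊔ U)) ⊓ (K ⊓ formPerp T W) ≤ K ⊓ formPerp T ⊤ := by
      rintro x ⟨⟨hx, h⟩, -, h'⟩
      refine ⟨hx, ?_⟩
      rw [← htop, formPerp_sup]
      exact ⟨h', formPerp_anti le_sup_right h⟩
    have h5 := Submodule.finrank_mono h3
    have h6 := Submodule.finrank_mono h4
    omega
  -- Adding radical vectors to `W` leaves its index unchanged, so only the codimension of `W + R`
  -- separates `i₊(W)` from `i₊(E)`.
  · set R := formPerp T ⊤ ⊓ (K ⊔ U)
    have hR : R ≤ formPerp T W := inf_le_left.trans (formPerp_anti le_top)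
    have h0 : NonposOn T R := fun x hx => (quadForm_eq_zero_of_mem_formPerp hx.1 trivial).le
    have h1 := posIndex_sup_of_orthogonal_nonpos hT hR h0
    have h2 := posIndex_le_add (T := T) (le_top : W ⊔ R ≤ ⊤)
    have h3 := Submodule.finrank_sup_add_finrank_inf_eq W R
    have h4 : W ⊓ R ≤ K ⊓ formPerp T ⊤ := by
      rintro x ⟨hx, hx', hxR⟩
      refine ⟨?_, hx'⟩
      have : x ∈ (K ⊔ U) ⊓ W := ⟨hxR, hx⟩
      rwa [sup_inf_assoc_of_le _ hKW, inf_comm, hWU, sup_bot_eq] at this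
    have h5 := Submodule.finrank_mono h4
    rw [finrank_top] at h2
    omega

/-- The vector `v` pairs with `x`: the index rises by at most one, while `x` leaves `K ∩ (K+U)^⊥`,
whose dimension drops by at least one. The radical part of `K + U` does not grow, as its vectors are
orthogonal to `x`. -/
theorem minPosIndex_mono_of_not_orthogonal (hx : x ∈ K ⊓ formPerp T (K ⊔ U))
    (hxv : inner ℂ (T x) v ≠ 0) (hT : T.IsSymmetric) (hv : v ∉ K ⊔ U) :
    minPosIndex T U (K ⊔ ℂ ∙ v) ≤ minPosIndex T U K := by
  have hvK : v ∉ K := fun h => hv (Submodule.mem_sup_left h)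
  have hxKU : ∀ k ∈ K ⊔ U, inner ℂ (T x) k = 0 := fun k hk =>
    (inner_comm_zero hT).1 (mem_formPerp.1 hx.2 k hk)
  have h1 := posIndex_sup_span_le (T := T) hvK
  have h2 : (K ⊔ ℂ ∙ v) ⊓ formPerp T (K ⊔ ℂ ∙ v ⊔ U) < K ⊓ formPerp T (K ⊔ U) := by
    refine lt_of_le_of_ne ?_ fun h => ?_
    · intro y hy
      refine ⟨mem_of_mem_sup_span (fun k hk => hxKU k (Submodule.mem_sup_left hk)) hxv hy.1 ?_, ?_⟩
      · exact mem_formPerp.1 hy.2 x (Submodule.mem_sup_left (Submodule.mem_sup_left hx.1))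
      · exact formPerp_anti (sup_le_sup_right le_sup_left _) hy.2
    · rw [← h] at hx
      exact hxv ((inner_comm_zero hT).1 (mem_formPerp.1 hx.2 v (Submodule.mem_sup_left
        (Submodule.mem_sup_right (Submodule.mem_span_singleton_self v)))))
  have h3 : formPerp T ⊤ ⊓ (K ⊔ ℂ ∙ v ⊔ U) ≤ formPerp T ⊤ ⊓ (K ⊔ U) := by
    refine fun y hy => ⟨hy.1, mem_of_mem_sup_span hxKU hxv ?_ (mem_formPerp.1 hy.1 x trivial)⟩
    rw [sup_right_comm]
    exact hy.2
  have h4 : K ⊓ formPerp T ⊤ ≤ (K ⊔ ℂ ∙ v) ⊓ formPerp T ⊤ := inf_le_inf_right _ le_sup_left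
  have h2' := Submodule.finrank_lt_finrank_of_lt h2
  have h3' := Submodule.finrank_mono h3
  have h4' := Submodule.finrank_mono h4
  exact max_le_max (by omega) (by omega)

/-- The index is unchanged. The dimensions counted positively grow by at most one, and `dim(K ∩
rad)`, subtracted in both entries, grows by at least one. -/
theorem minPosIndex_mono_of_mem_radical (hT : T.IsSymmetric) (hv : v ∈ formPerp T ⊤)
    (hvKU : v ∉ K ⊔ U) : minPosIndex T U (K ⊔ ℂ ∙ v) ≤ minPosIndex T U K := by
  have hvK : v ∉ K := fun h => hvKU (Submodule.mem_sup_left h)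
  have hspan : (ℂ ∙ v) ≤ formPerp T ⊤ := span_singleton_le_formPerp hv
  have hrad : ∀ S : Submodule ℂ E, formPerp T ⊤ ≤ formPerp T S := fun _ => formPerp_anti le_top
  have h1 : posIndex T (K ⊔ ℂ ∙ v) = posIndex T K :=
    posIndex_sup_of_orthogonal_nonpos hT (hspan.trans (hrad _))
      (nonposOn_span_singleton (quadForm_eq_zero_of_mem_formPerp hv trivial).le)
  have h2 : (K ⊔ ℂ ∙ v) ⊓ formPerp T (K ⊔ ℂ ∙ v ⊔ U) ≤ (K ⊓ formPerp T (K ⊔ U)) ⊔ ℂ ∙ v := by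
    rintro y ⟨hy, hy'⟩
    obtain ⟨k, hk, w, hw, rfl⟩ := Submodule.mem_sup.1 hy
    refine Submodule.add_mem_sup ⟨hk, ?_⟩ hw
    exact ((formPerp T _).add_mem_iff_left (hrad _ (hspan hw))).1
      (formPerp_anti (sup_le_sup_right le_sup_left _) hy')
  have h3 : formPerp T ⊤ ⊓ (K ⊔ ℂ ∙ v ⊔ U) ≤ (formPerp T ⊤ ⊓ (K ⊔ U)) ⊔ ℂ ∙ v := by
    rintro y ⟨hy, hy'⟩
    rw [sup_right_comm] at hy'
    obtain ⟨k, hk, w, hw, rfl⟩ := Submodule.mem_sup.1 hy'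
    exact Submodule.add_mem_sup ⟨((formPerp T _).add_mem_iff_left (hspan hw)).1 hy, hk⟩ hw
  have h4 : (K ⊓ formPerp T ⊤) ⊔ ℂ ∙ v ≤ (K ⊔ ℂ ∙ v) ⊓ formPerp T ⊤ :=
    sup_le (inf_le_inf_right _ le_sup_left) (le_inf le_sup_right hspan)
  have h2' := Submodule.finrank_mono h2
  have h3' := Submodule.finrank_mono h3
  have h4' := Submodule.finrank_mono h4
  rw [finrank_sup_span fun h => hvK (Submodule.mem_inf.1 h).1] at h2' h4'
  rw [finrank_sup_span fun h => hvKU (Submodule.mem_inf.1 h).2] at h3'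
  exact max_le_max (by omega) (by omega)

/-- Once `rad ≤ K + U`, the second entry of the bound can no longer grow. The first is safe if the
index stays put, or if it rises by one while strictly below the second. -/
theorem minPosIndex_mono_of_radical_le (hrad : formPerp T ⊤ ≤ K ⊔ U)
    (hZ : (K ⊔ ℂ ∙ v) ⊓ formPerp T (K ⊔ ℂ ∙ v ⊔ U) ≤ K ⊓ formPerp T (K ⊔ U))
    (hpos : posIndex T (K ⊔ ℂ ∙ v) ≤ posIndex T K ∨
      posIndex T (K ⊔ ℂ ∙ v) ≤ posIndex T K + 1 ∧
      finrank ℂ ↥(K ⊓ formPerp T (K ⊔ U)) ≤ finrank ℂ ↥(K ⊓ formPerp T ⊤) ∧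
      posIndex T K + finrank ℂ U + finrank ℂ ↥(K ⊓ formPerp T ⊤) <
        posIndex T ⊤ + finrank ℂ ↥(formPerp T ⊤)) :
    minPosIndex T U (K ⊔ ℂ ∙ v) ≤ minPosIndex T U K := by
  have h3 : formPerp T ⊤ ⊓ (K ⊔ ℂ ∙ v ⊔ U) ≤ formPerp T ⊤ := inf_le_left
  have h4 : K ⊓ formPerp T ⊤ ≤ (K ⊔ ℂ ∙ v) ⊓ formPerp T ⊤ := inf_le_inf_right _ le_sup_left
  have h2' := Submodule.finrank_mono hZ
  have h3' := Submodule.finrank_mono h3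
  have h4' := Submodule.finrank_mono h4
  rcases hpos with h | ⟨h, hz, h'⟩
  · rw [minPosIndex, minPosIndex, inf_eq_left.2 hrad]
    exact max_le_max (by omega) (by omega)
  · rw [minPosIndex, minPosIndex, inf_eq_left.2 hrad]
    refine max_le (le_max_of_le_right ?_) (le_max_of_le_right ?_) <;> omega

/-- Extending `K` by a vector orthogonal to `K` on which the form is definite. -/
theorem minPosIndex_mono_of_definite (hT : T.IsSymmetric) (hrad : formPerp T ⊤ ≤ K ⊔ U)
    (hz : K ⊓ formPerp T (K ⊔ U) ≤ formPerp T ⊤)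
    (hlt : posIndex T K + finrank ℂ U + finrank ℂ ↥(K ⊓ formPerp T ⊤) <
        posIndex T ⊤ + finrank ℂ ↥(formPerp T ⊤))
    (hv : v ∈ formPerp T K) (hvKU : v ∉ K ⊔ U) (hpos : 0 < quadForm T v) :
    minPosIndex T U (K ⊔ ℂ ∙ v) ≤ minPosIndex T U K ∧
      minPosIndex (-T) U (K ⊔ ℂ ∙ v) ≤ minPosIndex (-T) U K := by
  have hvK : v ∉ K := fun h => hvKU (Submodule.mem_sup_left h)
  have hZ : (K ⊔ ℂ ∙ v) ⊓ formPerp T (K ⊔ ℂ ∙ v ⊔ U) ≤ K ⊓ formPerp T (K ⊔ U) := fun y hy =>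
    ⟨mem_sup_span_orthogonal hT hv hy.1 (mem_formPerp.1 hy.2 v (Submodule.mem_sup_left
      (Submodule.mem_sup_right (Submodule.mem_span_singleton_self v)))) hpos.ne',
      formPerp_anti (sup_le_sup_right le_sup_left _) hy.2⟩
  constructor
  · exact minPosIndex_mono_of_radical_le hrad hZ (Or.inr ⟨posIndex_sup_span_le hvK,
      Submodule.finrank_mono (le_inf inf_le_left hz), hlt⟩)
  · refine minPosIndex_mono_of_radical_le ?_ ?_ (Or.inl ?_)
    · rwa [formPerp_neg]
    · rwa [formPerp_neg, formPerp_neg]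
    · refine (posIndex_sup_of_orthogonal_nonpos (isSymmetric_neg hT) ?_ ?_).le
      · rw [formPerp_neg]
        exact span_singleton_le_formPerp hv
      · exact nonposOn_span_singleton (by simpa using hpos.le)

/-- If some vector of `K ∩ (K+U)^⊥` is not radical, take `v` pairing with it; if `rad` is not inside
`K + U`, take `v` radical. Otherwise the first entries are just `i±(K)`. If one of them is strictly
below its second entry, adjoin a vector of that sign orthogonal to `K`: the other index does not
change. If neither is, adjoin an isotropic vector orthogonal to `K`, which raises neither index. -/
theorem exists_minPosIndex_step (hT : T.IsSymmetric) (hKU : K ⊓ U = ⊥) (hne : K ⊔ U ≠ ⊤) :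
    ∃ v ∉ K ⊔ U, minPosIndex T U (K ⊔ ℂ ∙ v) ≤ minPosIndex T U K ∧
      minPosIndex (-T) U (K ⊔ ℂ ∙ v) ≤ minPosIndex (-T) U K := by
  by_cases hz : K ⊓ formPerp T (K ⊔ U) ≤ formPerp T ⊤
  swap
  · obtain ⟨x, hx, hx'⟩ := Set.not_subset.1 hz
    obtain ⟨v, hv⟩ : ∃ v, inner ℂ (T x) v ≠ 0 := by
      by_contra! h
      exact hx' (mem_formPerp.2 fun w _ => (inner_comm_zero hT).1 (h w))
    have hvKU : v ∉ K ⊔ U := fun h =>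
      hv ((inner_comm_zero hT).1 (mem_formPerp.1 hx.2 v h))
    refine ⟨v, hvKU, minPosIndex_mono_of_not_orthogonal hx hv hT hvKU,
      minPosIndex_mono_of_not_orthogonal (x := x) ?_ ?_ (isSymmetric_neg hT) hvKU⟩
    · rwa [formPerp_neg]
    · simpa using hv
  by_cases hrad : formPerp T ⊤ ≤ K ⊔ U
  swap
  · obtain ⟨v, hv, hv'⟩ := Set.not_subset.1 hrad
    refine ⟨v, hv', minPosIndex_mono_of_mem_radical hT hv hv',
      minPosIndex_mono_of_mem_radical (isSymmetric_neg hT) ?_ hv'⟩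
    rwa [formPerp_neg]
  have hZ : K ⊓ formPerp T (K ⊔ U) = K ⊓ formPerp T ⊤ :=
    le_antisymm (le_inf inf_le_left hz) (inf_le_inf_left _ (formPerp_anti le_top))
  set N := K ⊓ formPerp T K with hN
  have hc : finrank ℂ ↥(K ⊔ U) < finrank ℂ E := Submodule.finrank_lt hne
  have hku := Submodule.finrank_sup_add_finrank_inf_eq K U
  rw [hKU, finrank_bot] at hku
  have hNZ : N ⊓ formPerp T (K ⊔ U) = K ⊓ formPerp T ⊤ := by
    rw [hN, inf_assoc, inf_eq_right.2 (formPerp_anti le_sup_left : formPerp T (K ⊔ U) ≤ _), hZ]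
  have d1 := finrank_formPerp_inf hT N (K ⊔ U)
  rw [hNZ] at d1
  have d2 := finrank_formPerp_inf hT (K ⊔ U) ⊤
  rw [inf_top_eq, finrank_top, inf_eq_right.2 hrad] at d2
  have d3 := finrank_formPerp_inf hT K ⊤
  rw [inf_top_eq, finrank_top] at d3
  have d4 := Submodule.finrank_sup_add_finrank_inf_eq K (formPerp T ⊤)
  have hNK : formPerp T K ≤ formPerp T N := formPerp_anti inf_le_left
  have hKN : K ≤ formPerp T N := (le_formPerp_comm hT).2 inf_le_right
  have d5 := Submodule.finrank_mono (sup_le (le_inf hKN le_sup_left)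
    (le_inf (formPerp_anti le_top) hrad) : K ⊔ formPerp T ⊤ ≤ formPerp T N ⊓ (K ⊔ U))
  have d6 := Submodule.finrank_sup_add_finrank_inf_eq K (formPerp T K)
  rw [← hN] at d6
  have e1 := posIndex_decomposition hT (le_top : K ≤ ⊤)
  have e2 := posIndex_decomposition (isSymmetric_neg hT) (le_top : K ≤ ⊤)
  rw [formPerp_neg, formPerp_neg, inf_top_eq, ← hN] at e2
  rw [inf_top_eq, ← hN] at e1
  have e3 := posIndex_add_negIndex hT ⊤
  rw [top_inf_eq, finrank_top] at e3
  have e4 := posIndex_add_negIndex hT K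
  rw [← hN] at e4
  -- Otherwise `K + K^⊥` would lie in `N^⊥ ∩ (K+U)`, which is too small because `K + U ≠ E`.
  have hperp : ¬ formPerp T K ≤ K ⊔ U := fun h => by
    have := Submodule.finrank_mono (sup_le (le_inf hKN le_sup_left) (le_inf hNK h) :
      K ⊔ formPerp T K ≤ formPerp T N ⊓ (K ⊔ U))
    omega
  by_cases hp : posIndex T K + finrank ℂ U + finrank ℂ ↥(K ⊓ formPerp T ⊤) <
      posIndex T ⊤ + finrank ℂ ↥(formPerp T ⊤)
  -- The decomposition `e1` and the slack `hp` give `i₊(K^⊥) > 0`, since `d5` yields `dim N + dim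
  -- rad ≤ dim U + 2 dim(K ∩ rad)`.
  · obtain ⟨x, hx, hx0⟩ := exists_pos_of_posIndex (T := T) (W := formPerp T K) (by omega)
    obtain ⟨v, hv, hvKU, hpos⟩ := exists_pos_notMem hT hperp hx hx0
    exact ⟨v, hvKU, minPosIndex_mono_of_definite hT hrad hz hp hv hvKU hpos⟩
  by_cases hn : posIndex (-T) K + finrank ℂ U + finrank ℂ ↥(K ⊓ formPerp T ⊤) <
      posIndex (-T) ⊤ + finrank ℂ ↥(formPerp T ⊤)
  · obtain ⟨x, hx, hx0⟩ := exists_pos_of_posIndex (T := -T) (W := formPerp T K) (by omega)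
    obtain ⟨v, hv, hvKU, hpos⟩ := exists_pos_notMem (isSymmetric_neg hT) hperp hx hx0
    have := minPosIndex_mono_of_definite (K := K) (U := U) (isSymmetric_neg hT)
      (by rwa [formPerp_neg]) (by rwa [formPerp_neg, formPerp_neg])
      (by rwa [formPerp_neg]) (by rwa [formPerp_neg]) hvKU hpos
    rw [neg_neg] at this
    exact ⟨v, hvKU, this.symm⟩
  -- Lack of slack for one sign forces the other sign to occur on `K^⊥`: by Sylvester's law its
  -- index there is at least `dim E - dim K - dim U > 0`. Hence `K^⊥` is indefinite.
  obtain ⟨a, ha, ha0⟩ := exists_pos_of_posIndex (T := T) (W := formPerp T K) (by omega)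
  obtain ⟨b, hb, hb0⟩ := exists_pos_of_posIndex (T := -T) (W := formPerp T K) (by omega)
  have d7 := Submodule.finrank_sup_add_finrank_inf_eq N (formPerp T (K ⊔ U))
  rw [hNZ] at d7
  -- Avoiding `N + (K+U)^⊥` keeps `K ∩ (K+U)^⊥` from growing when `v` is adjoined. Containment would
  -- give `dim U + 2 dim(K ∩ rad) ≤ dim N + dim rad`, and the absence of slack would then force
  -- `i₊(K^⊥) = 0`.
  have hperp' : ¬ formPerp T K ≤ N ⊔ formPerp T (K ⊔ U) := fun h => by
    have := Submodule.finrank_mono h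
    omega
  obtain ⟨v, hv, hvKU, hv', hv0⟩ := exists_isotropic_notMem_notMem hT hperp hperp'
    (fun a ha b hb => by
      obtain ⟨c, hc, d, hd, rfl⟩ := Submodule.mem_sup.1 hb.2
      rw [inner_add_right, mem_formPerp.1 hd a ha.2, add_zero]
      exact (inner_comm_zero hT).1 (mem_formPerp.1 ha.1 c hc.1)) ha ha0 hb (by simpa using hb0)
  have hZv : (K ⊔ ℂ ∙ v) ⊓ formPerp T (K ⊔ ℂ ∙ v ⊔ U) ≤ K ⊓ formPerp T (K ⊔ U) := by
    rintro y ⟨hy, hy'⟩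
    have hy2 := formPerp_anti (sup_le_sup_right le_sup_left _ : K ⊔ U ≤ K ⊔ ℂ ∙ v ⊔ U) hy'
    refine ⟨?_, hy2⟩
    obtain ⟨k, hk, w, hw, rfl⟩ := Submodule.mem_sup.1 hy
    obtain ⟨t, rfl⟩ := Submodule.mem_span_singleton.1 hw
    have hkN : k ∈ N := ⟨hk, ((formPerp T K).add_mem_iff_left ((formPerp T K).smul_mem t hv)).1
      (formPerp_anti le_sup_left hy2)⟩
    have ht : t = 0 := by
      by_contra ht
      refine hv' (((N ⊔ formPerp T (K ⊔ U)).smul_mem_iff ht).1 ?_)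
      exact ((N ⊔ formPerp T (K ⊔ U)).add_mem_iff_right (Submodule.mem_sup_left hkN)).1
        (Submodule.mem_sup_right hy2)
    simpa [ht] using hk
  refine ⟨v, hvKU, minPosIndex_mono_of_radical_le hrad hZv (Or.inl ?_),
    minPosIndex_mono_of_radical_le (by rwa [formPerp_neg])
      (by rwa [formPerp_neg, formPerp_neg]) (Or.inl ?_)⟩
  · exact (posIndex_sup_of_orthogonal_nonpos hT (span_singleton_le_formPerp hv)
      (nonposOn_span_singleton hv0.le)).le
  · exact (posIndex_sup_of_orthogonal_nonpos (isSymmetric_neg hT)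
      (by rw [formPerp_neg]; exact span_singleton_le_formPerp hv)
      (nonposOn_span_singleton (by simp [hv0]))).le

/-- Both minimal inertias are attained by one and the same complement of `U` containing `K`. -/
theorem exists_minPosIndex (hT : T.IsSymmetric) (hKU : K ⊓ U = ⊥) :
    ∃ W, K ≤ W ∧ W ⊓ U = ⊥ ∧ W ⊔ U = ⊤ ∧ posIndex T W = minPosIndex T U K ∧
      posIndex (-T) W = minPosIndex (-T) U K := by
  obtain ⟨W, hKW, h1, h2, h3, h4⟩ := exists_isCompl_of_step (U := U)
    (fun K K' => minPosIndex T U K' ≤ minPosIndex T U K ∧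
      minPosIndex (-T) U K' ≤ minPosIndex (-T) U K)
    (fun _ => ⟨le_rfl, le_rfl⟩) (fun _ _ _ h h' => ⟨h'.1.trans h.1, h'.2.trans h.2⟩)
    (fun K hK hne => exists_minPosIndex_step hT hK hne) hKU
  exact ⟨W, hKW, h1, h2, le_antisymm ((posIndex_le_minPosIndex h2).trans h3)
    (minPosIndex_le hT hKW h1 h2), le_antisymm ((posIndex_le_minPosIndex h2).trans h4)
    (minPosIndex_le (isSymmetric_neg hT) hKW h1 h2)⟩

end Extremal

/-! ### Maximal inertia and maximal rank -/

section Maximal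

variable {E : Type*} [NormedAddCommGroup E] [InnerProductSpace ℂ E] [FiniteDimensional ℂ E]
variable {T : E →ₗ[ℂ] E} {K W S U : Submodule ℂ E} {x y v : E}

/-- The largest positive inertia of the form of `T` on complements of `U` containing `K`. -/
noncomputable def maxPosIndex (T : E →ₗ[ℂ] E) (U K : Submodule ℂ E) : ℤ :=
  min (posIndex T K + (finrank ℂ E - finrank ℂ U - finrank ℂ K)) (posIndex T ⊤)

/-- The largest rank of the form of `T` on complements of `U` containing `K`. -/
noncomputable def maxRank (T : E →ₗ[ℂ] E) (U K : Submodule ℂ E) : ℤ :=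
  min (finrank ℂ E - finrank ℂ U - finrank ℂ ↥(K ⊓ formPerp T ⊤))
    (min (posIndex T K + posIndex (-T) K + 2 * (finrank ℂ E - finrank ℂ U - finrank ℂ K))
      (posIndex T ⊤ + posIndex (-T) ⊤))

theorem finrank_add_finrank_of_isCompl (hWU : W ⊓ U = ⊥) (htop : W ⊔ U = ⊤) :
    finrank ℂ W + finrank ℂ U = finrank ℂ E := by
  have hw := Submodule.finrank_sup_add_finrank_inf_eq W U
  rw [hWU, htop, finrank_bot, finrank_top] at hw
  omega

theorem posIndex_le_maxPosIndex (hKW : K ≤ W) (hWU : W ⊓ U = ⊥) (htop : W ⊔ U = ⊤) :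
    posIndex T W ≤ maxPosIndex T U K := by
  have h1 := finrank_add_finrank_of_isCompl hWU htop
  have h2 := posIndex_le_add (T := T) hKW
  have h3 := posIndex_mono (T := T) (le_top : W ≤ ⊤)
  exact le_min (by omega) (by omega)

theorem rank_le_maxRank (hT : T.IsSymmetric) (hKW : K ≤ W) (hWU : W ⊓ U = ⊥) (htop : W ⊔ U = ⊤) :
    (posIndex T W + posIndex (-T) W : ℤ) ≤ maxRank T U K := by
  have h1 := finrank_add_finrank_of_isCompl hWU htop
  have h2 := posIndex_le_add (T := T) hKW
  have h2' := posIndex_le_add (T := -T) hKW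
  have h3 := posIndex_mono (T := T) (le_top : W ≤ ⊤)
  have h3' := posIndex_mono (T := -T) (le_top : W ≤ ⊤)
  have h4 := posIndex_add_negIndex hT W
  have h5 := Submodule.finrank_mono (inf_le_inf hKW (formPerp_anti le_top) :
    K ⊓ formPerp T ⊤ ≤ W ⊓ formPerp T W)
  exact le_min (by omega) (le_min (by omega) (by omega))

theorem finrank_add_le_of_notMem (hKU : K ⊓ U = ⊥) (hv : v ∉ K ⊔ U) :
    finrank ℂ K + 1 + finrank ℂ U ≤ finrank ℂ E := by
  have h2 := Submodule.finrank_sup_add_finrank_inf_eq (K ⊔ ℂ ∙ v) U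
  rw [sup_span_inf_eq_bot hKU hv, finrank_bot,
    finrank_sup_span fun h => hv (Submodule.mem_sup_left h)] at h2
  have h3 := Submodule.finrank_le (K ⊔ ℂ ∙ v ⊔ U)
  omega

/-- If `i₊(K)` already equals `i₊(E)`, any new vector will do. Otherwise let `P ≤ K` be maximal
positive definite; then `E = P ⊕ P^⊥`, and a positive vector of `P^⊥` outside `K + U` raises the
index by one, offsetting the drop in available dimension. -/
theorem exists_maxPosIndex_step (hT : T.IsSymmetric) (hKU : K ⊓ U = ⊥) (hne : K ⊔ U ≠ ⊤) :
    ∃ v ∉ K ⊔ U, maxPosIndex T U K ≤ maxPosIndex T U (K ⊔ ℂ ∙ v) := by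
  by_cases hp : posIndex T ⊤ ≤ posIndex T K
  · obtain ⟨v, -, hv⟩ := SetLike.exists_of_lt hne.lt_top
    refine ⟨v, hv, ?_⟩
    have h1 := posIndex_mono (T := T) (le_sup_left : K ≤ K ⊔ ℂ ∙ v)
    have h2 := finrank_add_le_of_notMem hKU hv
    have h3 := finrank_sup_span fun h => hv (Submodule.mem_sup_left h)
    exact (min_le_right _ _).trans (le_min (by omega) le_rfl)
  · obtain ⟨P, hPK, hP, hd⟩ := exists_posDefOn T K
    have hdisj : P ⊓ formPerp T P = ⊥ := hP.inf_formPerp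
    have h1 := posIndex_decomposition hT (le_top : P ≤ ⊤)
    have h2 := finrank_sup_formPerp hT (le_top : P ≤ ⊤)
    rw [inf_top_eq, hdisj, finrank_bot] at h1 h2
    have h3 : P ⊔ formPerp T P = ⊤ :=
      Submodule.eq_of_le_of_finrank_le le_top (by omega)
    have h4 := posIndex_le_of_le_sup (T := T) (W := P) (P := P) (N := ⊥) le_sup_left
      (by intro x hx; simp [(Submodule.mem_bot ℂ).1 hx])
    obtain ⟨x, hx, hx0⟩ := exists_pos_of_posIndex (T := T) (W := formPerp T P) (by omega)
    have h5 : ¬ formPerp T P ≤ K ⊔ U := fun h =>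
      hne (top_le_iff.1 (h3 ▸ sup_le (hPK.trans le_sup_left) h))
    obtain ⟨v, hv, hvKU, hpos⟩ := exists_pos_notMem hT h5 hx hx0
    have hvK : v ∉ K := fun h => hvKU (Submodule.mem_sup_left h)
    have h6 := (hP.sup hT (posDefOn_span_singleton hpos)
      (span_singleton_le_formPerp hv)).finrank_le_posIndex
      (sup_le_sup_right hPK _ : P ⊔ ℂ ∙ v ≤ K ⊔ ℂ ∙ v)
    rw [finrank_sup_span fun h => hvK (hPK h)] at h6
    have h7 := finrank_sup_span hvK
    exact ⟨v, hvKU, min_le_min (by omega) le_rfl⟩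

theorem exists_maxPosIndex (hT : T.IsSymmetric) (hKU : K ⊓ U = ⊥) :
    ∃ W, K ≤ W ∧ W ⊓ U = ⊥ ∧ W ⊔ U = ⊤ ∧ posIndex T W = maxPosIndex T U K := by
  obtain ⟨W, hKW, h1, h2, h3⟩ := exists_isCompl_of_step (U := U)
    (fun K K' => maxPosIndex T U K ≤ maxPosIndex T U K')
    (fun _ => le_rfl) (fun _ _ _ h h' => h.trans h')
    (fun K hK hne => exists_maxPosIndex_step hT hK hne) hKU
  refine ⟨W, hKW, h1, h2, le_antisymm (posIndex_le_maxPosIndex hKW h1 h2) (h3.trans ?_)⟩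
  have := finrank_add_finrank_of_isCompl h1 h2
  exact (min_le_left _ _).trans (by omega)

/-- If `K` has a radical vector `x` outside `rad`, a new vector pairing with `x` raises the rank by
two. If the rank on `K` is already full, any new vector works. Otherwise `E = K + K^⊥`, and a
non-isotropic vector of `K^⊥` raises the rank without enlarging `K ∩ rad`. -/
theorem exists_maxRank_step (hT : T.IsSymmetric) (hKU : K ⊓ U = ⊥) (hne : K ⊔ U ≠ ⊤) :
    ∃ v ∉ K ⊔ U, maxRank T U K ≤ maxRank T U (K ⊔ ℂ ∙ v) := by
  by_cases hrad : K ⊓ formPerp T K ≤ formPerp T ⊤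
  swap
  · obtain ⟨x, hx, hx'⟩ := Set.not_subset.1 hrad
    have hxK : ∀ k ∈ K, inner ℂ (T x) k = 0 := fun k hk =>
      (inner_comm_zero hT).1 (mem_formPerp.1 hx.2 k hk)
    have hne' : formPerp T (ℂ ∙ x) ≠ ⊤ := fun h => hx' (mem_formPerp.2 fun w _ =>
      (inner_comm_zero hT).1 (mem_formPerp.1 (h ▸ Submodule.mem_top : w ∈ formPerp T (ℂ ∙ x)) x
        (Submodule.mem_span_singleton_self x)))
    obtain ⟨v, hvKU, hv⟩ := exists_notMem_notMem hne hne'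
    have hvK : v ∉ K := fun h => hvKU (Submodule.mem_sup_left h)
    have hxv : inner ℂ (T x) v ≠ 0 := fun h => hv (mem_formPerp.2 fun w hw => by
      obtain ⟨a, rfl⟩ := Submodule.mem_span_singleton.1 hw
      rw [map_smul, inner_smul_left, h, mul_zero])
    have h1 : (K ⊔ ℂ ∙ v) ⊓ formPerp T ⊤ ≤ K ⊓ formPerp T ⊤ := fun y hy =>
      ⟨mem_of_mem_sup_span hxK hxv hy.1 (mem_formPerp.1 hy.2 x trivial), hy.2⟩
    have h2 : (K ⊔ ℂ ∙ v) ⊓ formPerp T (K ⊔ ℂ ∙ v) < K ⊓ formPerp T K := by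
      refine lt_of_le_of_ne ?_ fun h => ?_
      · exact fun y hy => ⟨mem_of_mem_sup_span hxK hxv hy.1
          (mem_formPerp.1 hy.2 x (Submodule.mem_sup_left hx.1)), formPerp_anti le_sup_left hy.2⟩
      · rw [← h] at hx
        exact hxv ((inner_comm_zero hT).1 (mem_formPerp.1 hx.2 v
          (Submodule.mem_sup_right (Submodule.mem_span_singleton_self v))))
    have h1' := Submodule.finrank_mono h1
    have h2' := Submodule.finrank_lt_finrank_of_lt h2
    have h3 := posIndex_add_negIndex hT K
    have h4 := posIndex_add_negIndex hT (K ⊔ ℂ ∙ v)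
    have h5 := finrank_sup_span hvK
    exact ⟨v, hvKU, min_le_min (by omega) (min_le_min (by omega) le_rfl)⟩
  by_cases hr : posIndex T ⊤ + posIndex (-T) ⊤ ≤ posIndex T K + posIndex (-T) K
  · obtain ⟨v, -, hv⟩ := SetLike.exists_of_lt hne.lt_top
    have h1 := posIndex_mono (T := T) (le_sup_left : K ≤ K ⊔ ℂ ∙ v)
    have h1' := posIndex_mono (T := -T) (le_sup_left : K ≤ K ⊔ ℂ ∙ v)
    have h2 := finrank_add_le_of_notMem hKU hv
    have h3 := finrank_sup_span fun h => hv (Submodule.mem_sup_left h)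
    have h4 := posIndex_add_negIndex hT (K ⊔ ℂ ∙ v)
    have h5 := Submodule.finrank_mono (inf_le_inf_left _ (formPerp_anti le_top) :
      (K ⊔ ℂ ∙ v) ⊓ formPerp T ⊤ ≤ (K ⊔ ℂ ∙ v) ⊓ formPerp T (K ⊔ ℂ ∙ v))
    exact ⟨v, hv, (min_le_right _ _).trans ((min_le_right _ _).trans
      (le_min (by omega) (le_min (by omega) le_rfl)))⟩
  · have hZ : K ⊓ formPerp T K = K ⊓ formPerp T ⊤ :=
      le_antisymm (le_inf inf_le_left hrad) (inf_le_inf_left _ (formPerp_anti le_top))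
    have e1 := posIndex_decomposition hT (le_top : K ≤ ⊤)
    have e2 := posIndex_decomposition (isSymmetric_neg hT) (le_top : K ≤ ⊤)
    have e3 := finrank_sup_formPerp hT (le_top : K ≤ ⊤)
    rw [formPerp_neg, formPerp_neg, inf_top_eq, hZ] at e2
    rw [inf_top_eq, hZ] at e1 e3
    have h3 : K ⊔ formPerp T K = ⊤ := Submodule.eq_of_le_of_finrank_le le_top (by omega)
    have h5 : ¬ formPerp T K ≤ K ⊔ U := fun h =>
      hne (top_le_iff.1 (h3 ▸ sup_le le_sup_left h))
    obtain ⟨v, hv, hvKU, hv0⟩ : ∃ v ∈ formPerp T K, v ∉ K ⊔ U ∧ quadForm T v ≠ 0 := by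
      by_cases hp : 0 < posIndex T (formPerp T K)
      · obtain ⟨x, hx, hx0⟩ := exists_pos_of_posIndex hp
        obtain ⟨v, hv, hvKU, hpos⟩ := exists_pos_notMem hT h5 hx hx0
        exact ⟨v, hv, hvKU, hpos.ne'⟩
      · obtain ⟨x, hx, hx0⟩ := exists_pos_of_posIndex (T := -T) (W := formPerp T K) (by omega)
        obtain ⟨v, hv, hvKU, hpos⟩ := exists_pos_notMem (isSymmetric_neg hT) h5 hx hx0
        exact ⟨v, hv, hvKU, fun h => by simp [h] at hpos⟩
    have hvK : v ∉ K := fun h => hvKU (Submodule.mem_sup_left h)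
    have h1 : (K ⊔ ℂ ∙ v) ⊓ formPerp T ⊤ ≤ K ⊓ formPerp T ⊤ := fun y hy =>
      ⟨mem_sup_span_orthogonal hT hv hy.1 (mem_formPerp.1 hy.2 v trivial) hv0, hy.2⟩
    have h2 : (K ⊔ ℂ ∙ v) ⊓ formPerp T (K ⊔ ℂ ∙ v) ≤ K ⊓ formPerp T K := fun y hy =>
      ⟨mem_sup_span_orthogonal hT hv hy.1 (mem_formPerp.1 hy.2 v
        (Submodule.mem_sup_right (Submodule.mem_span_singleton_self v))) hv0,
        formPerp_anti le_sup_left hy.2⟩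
    have h1' := Submodule.finrank_mono h1
    have h2' := Submodule.finrank_mono h2
    have h3 := posIndex_add_negIndex hT K
    have h4 := posIndex_add_negIndex hT (K ⊔ ℂ ∙ v)
    have h5 := finrank_sup_span hvK
    have h6 := finrank_add_le_of_notMem hKU hvKU
    have h7 := congrArg (fun S : Submodule ℂ E => finrank ℂ S) hZ
    refine ⟨v, hvKU, le_min ?_ (le_min ?_ ?_)⟩
    · exact (min_le_left _ _).trans (by omega)
    -- The rank rises by only one here, so the second entry may drop; since the rank on `K` is `dim
    -- K - dim(K ∩ rad)`, it still dominates the first entry.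
    · exact (min_le_left _ _).trans (by omega)
    · exact (min_le_right _ _).trans (min_le_right _ _)

theorem exists_maxRank (hT : T.IsSymmetric) (hKU : K ⊓ U = ⊥) :
    ∃ W, K ≤ W ∧ W ⊓ U = ⊥ ∧ W ⊔ U = ⊤ ∧
      (posIndex T W + posIndex (-T) W : ℤ) = maxRank T U K := by
  obtain ⟨W, hKW, h1, h2, h3⟩ := exists_isCompl_of_step (U := U)
    (fun K K' => maxRank T U K ≤ maxRank T U K')
    (fun _ => le_rfl) (fun _ _ _ h h' => h.trans h')
    (fun K hK hne => exists_maxRank_step hT hK hne) hKU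
  refine ⟨W, hKW, h1, h2, le_antisymm (rank_le_maxRank hT hKW h1 h2) (h3.trans ?_)⟩
  have := finrank_add_finrank_of_isCompl h1 h2
  exact (min_le_right _ _).trans ((min_le_left _ _).trans (by omega))

end Maximal

/-! ### Transport along injections and counting eigenvalues -/

section General

variable {E E' : Type*} [NormedAddCommGroup E] [InnerProductSpace ℂ E]
  [NormedAddCommGroup E'] [InnerProductSpace ℂ E']
variable {T : E →ₗ[ℂ] E} {T' : E' →ₗ[ℂ] E'}

theorem mem_formPerp_top (hT : T.IsSymmetric) {x : E} : x ∈ formPerp T ⊤ ↔ T x = 0 := by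
  rw [mem_formPerp]
  constructor
  · intro h
    refine ext_inner_left ℂ fun w => ?_
    rw [← hT, h w trivial, inner_zero_right]
  · intro h w _
    rw [hT, h, inner_zero_right]

theorem finrank_map_of_injective {F G : Type*} [AddCommGroup F] [Module ℂ F] [AddCommGroup G]
    [Module ℂ G] {J : F →ₗ[ℂ] G} (hJ : Function.Injective J) (W : Submodule ℂ F) :
    finrank ℂ ↥(W.map J) = finrank ℂ W :=
  (Submodule.equivMapOfInjective J hJ W).finrank_eq.symm

theorem quadForm_eq_sum {ι : Type*} [Fintype ι] (b : OrthonormalBasis ι ℂ E) {l : ι → ℝ}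
    (hb : ∀ i, T (b i) = (l i : ℂ) • b i) (x : E) :
    quadForm T x = ∑ i, l i * Complex.normSq (b.repr x i) := by
  have h1 : T x = ∑ i, (b.repr x i * l i) • b i := by
    conv_lhs => rw [← b.sum_repr x]
    simp only [map_sum, map_smul, hb, smul_smul]
  rw [quadForm, h1, sum_inner, Complex.re_sum]
  refine Finset.sum_congr rfl fun i _ => ?_
  rw [inner_smul_left, ← b.repr_apply_apply, map_mul, Complex.conj_ofReal, mul_right_comm,
    ← Complex.normSq_eq_conj_mul_self]
  norm_cast
  ring

theorem repr_eq_zero_of_mem_span {ι : Type*} [Fintype ι] (b : OrthonormalBasis ι ℂ E) {s : Set ι}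
    {x : E} (hx : x ∈ Submodule.span ℂ (b '' s)) {i : ι} (hi : i ∉ s) : b.repr x i = 0 := by
  rw [← b.coe_toBasis, b.toBasis.mem_span_image] at hx
  by_contra h
  exact hi (hx (Finsupp.mem_support_iff.2 (by simpa using h)))

variable [FiniteDimensional ℂ E] [FiniteDimensional ℂ E']

theorem posIndex_map {J : E' →ₗ[ℂ] E} (hJ : Function.Injective J)
    (h : ∀ x, quadForm T (J x) = quadForm T' x) (W : Submodule ℂ E') :
    posIndex T (W.map J) = posIndex T' W := by
  apply le_antisymm
  · obtain ⟨S, hS, hp, hd⟩ := exists_posDefOn T (W.map J)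
    have hSJ : (S.comap J).map J = S :=
      Submodule.map_comap_eq_self (hS.trans LinearMap.map_le_range)
    rw [← hd, ← hSJ, finrank_map_of_injective hJ]
    refine PosDefOn.finrank_le_posIndex (fun x hx h0 => ?_) ?_
    · rw [← h]
      exact hp _ hx ((map_ne_zero_iff J hJ).2 h0)
    · rw [← Submodule.map_le_map_iff_of_injective hJ, hSJ]
      exact hS
  · obtain ⟨S, hS, hp, hd⟩ := exists_posDefOn T' W
    rw [← hd, ← finrank_map_of_injective hJ]
    refine PosDefOn.finrank_le_posIndex ?_ (Submodule.map_mono hS)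
    rintro _ ⟨x, hx, rfl⟩ h0
    rw [h]
    exact hp x hx (by rintro rfl; simp at h0)

/-- The form is positive definite on the span of the eigenvectors with `0 < l i` and nonpositive on
the span of the others; together they span the space. -/
theorem posIndex_top_eq_card {ι : Type*} [Fintype ι] (b : OrthonormalBasis ι ℂ E) {l : ι → ℝ}
    (hb : ∀ i, T (b i) = (l i : ℂ) • b i) :
    posIndex T ⊤ = (Finset.univ.filter fun i => 0 < l i).card := by
  classical
  set P := Submodule.span ℂ (b '' {i | 0 < l i})
  set N := Submodule.span ℂ (b '' {i | 0 < l i}ᶜ)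
  have hP : finrank ℂ P = (Finset.univ.filter fun i => 0 < l i).card := by
    have h1 : LinearIndependent ℂ (b ∘ ((↑) : {i // 0 < l i} → ι)) :=
      b.orthonormal.linearIndependent.comp _ Subtype.val_injective
    have h2 := finrank_span_eq_card h1
    rwa [Set.range_comp, Subtype.range_coe_subtype, Fintype.card_subtype] at h2
  have hpos : PosDefOn T P := by
    intro x hx h0
    rw [quadForm_eq_sum b hb]
    obtain ⟨j, hj⟩ : ∃ j, b.repr x j ≠ 0 := by
      by_contra! h
      refine h0 (b.repr.injective ?_)
      ext i
      simpa using h i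
    have hterm : ∀ i, 0 ≤ l i * Complex.normSq (b.repr x i) := fun i => by
      by_cases hi : 0 < l i
      · exact mul_nonneg hi.le (Complex.normSq_nonneg _)
      · simp [repr_eq_zero_of_mem_span b hx hi]
    refine Finset.sum_pos' (fun i _ => hterm i) ⟨j, Finset.mem_univ j, mul_pos ?_
      (Complex.normSq_pos.2 hj)⟩
    by_contra hj'
    exact hj (repr_eq_zero_of_mem_span b hx hj')
  have hneg : NonposOn T N := by
    intro x hx
    rw [quadForm_eq_sum b hb]
    refine Finset.sum_nonpos fun i _ => ?_
    by_cases hi : 0 < l i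
    · simp [repr_eq_zero_of_mem_span b hx (s := {i | 0 < l i}ᶜ) (i := i) (by simpa using hi)]
    · exact mul_nonpos_of_nonpos_of_nonneg (not_lt.1 hi) (Complex.normSq_nonneg _)
  have htop : P ⊔ N = ⊤ := by
    rw [← Submodule.span_union, ← Set.image_union, Set.union_compl_self, Set.image_univ,
      ← b.coe_toBasis, b.toBasis.span_eq]
  rw [← hP]
  exact le_antisymm (posIndex_le_of_le_sup htop.ge hneg) (hpos.finrank_le_posIndex le_top)

end General

/-! ### Inertia and rank of matrices in terms of forms and kernels -/

section MatrixInertia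

variable {ι κ : Type*} [Fintype ι] [DecidableEq ι]

theorem posInertia_eq_posIndex (H : Matrix ι ι ℂ) (hH : H.IsHermitian) :
    posInertia H hH = posIndex (toEuclideanLin H) ⊤ := by
  refine (posIndex_top_eq_card hH.eigenvectorBasis (l := hH.eigenvalues) fun i => ?_).symm
  ext j
  have := congrFun (hH.mulVec_eigenvectorBasis i) j
  simpa using this

theorem negInertia_eq_posIndex (H : Matrix ι ι ℂ) (hH : H.IsHermitian) :
    negInertia H hH = posIndex (-toEuclideanLin H) ⊤ := by
  rw [posIndex_top_eq_card hH.eigenvectorBasis (l := -hH.eigenvalues)]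
  · simp [negInertia]
  · intro i
    ext j
    have := congrFun (hH.mulVec_eigenvectorBasis i) j
    simpa using this

theorem isSymmetric_toEuclideanLin {H : Matrix ι ι ℂ} (hH : H.IsHermitian) :
    (toEuclideanLin H).IsSymmetric :=
  isSymmetric_toEuclideanLin_iff.2 hH

theorem mem_ker_toEuclideanLin (M : Matrix κ ι ℂ) {x : EuclideanSpace ℂ ι} :
    x ∈ (toEuclideanLin M).ker ↔ M *ᵥ x.ofLp = 0 := by
  rw [LinearMap.mem_ker, toLpLin_apply]
  exact WithLp.toLp_eq_zero 2

theorem rank_add_finrank_ker [Fintype κ] (M : Matrix κ ι ℂ) :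
    M.rank + finrank ℂ (toEuclideanLin M).ker = Fintype.card ι := by
  have h1 := (toEuclideanLin M).finrank_range_add_finrank_ker
  rw [finrank_euclideanSpace] at h1
  rw [← h1, rank_eq_finrank_range_toLin M (PiLp.basisFun 2 ℂ κ) (PiLp.basisFun 2 ℂ ι),
    ← toLpLin_eq_toLin]

theorem posInertia_add_negInertia (H : Matrix ι ι ℂ) (hH : H.IsHermitian) :
    posInertia H hH + negInertia H hH = H.rank := by
  have h1 := posIndex_add_negIndex (isSymmetric_toEuclideanLin hH) ⊤
  have h2 : (⊤ : Submodule ℂ (EuclideanSpace ℂ ι)) ⊓ formPerp (toEuclideanLin H) ⊤ =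
      (toEuclideanLin H).ker := by
    ext x
    rw [top_inf_eq, mem_formPerp_top (isSymmetric_toEuclideanLin hH), LinearMap.mem_ker]
  rw [h2, finrank_top, finrank_euclideanSpace, ← rank_add_finrank_ker H] at h1
  rw [posInertia_eq_posIndex, negInertia_eq_posIndex]
  omega

variable [Fintype κ]

open scoped ComplexOrder in
theorem rank_add_finrank_ker_conjTranspose (M : Matrix ι κ ℂ) :
    M.rank + finrank ℂ (toEuclideanLin Mᴴ).ker = Fintype.card ι := by
  rw [← rank_conjTranspose, rank_add_finrank_ker]

variable [DecidableEq κ]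

theorem inner_toEuclideanLin (M : Matrix ι κ ℂ) (x : EuclideanSpace ℂ κ) (y : EuclideanSpace ℂ ι) :
    inner ℂ (toEuclideanLin M x) y = inner ℂ x (toEuclideanLin Mᴴ y) := by
  rw [toEuclideanLin_conjTranspose_eq_adjoint, LinearMap.adjoint_inner_right]

theorem quadForm_conjTranspose_mul_mul (J : Matrix ι κ ℂ) (H : Matrix ι ι ℂ)
    (x : EuclideanSpace ℂ κ) :
    quadForm (toEuclideanLin (Jᴴ * H * J)) x = quadForm (toEuclideanLin H) (toEuclideanLin J x) := by
  rw [quadForm, quadForm, ← conjTranspose_conjTranspose J, ← inner_toEuclideanLin,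
    conjTranspose_conjTranspose]
  congr 2
  simp [toLpLin_apply, mulVec_mulVec, Matrix.mul_assoc]

theorem ker_conjTranspose_orthogonal (M : Matrix ι κ ℂ) :
    (toEuclideanLin Mᴴ).kerᗮ = (toEuclideanLin M).range := by
  rw [LinearMap.orthogonal_ker, ← toEuclideanLin_conjTranspose_eq_adjoint,
    conjTranspose_conjTranspose]

end MatrixInertia

/-! ### Direct sums and bordered Hermitian matrices -/

section Blocks

variable {ι κ μ : Type*}

/-- The inclusion of the first summand of `ℂ^ι ⊕ ℂ^κ`. -/
def inlLin (ι κ : Type*) : EuclideanSpace ℂ ι →ₗ[ℂ] EuclideanSpace ℂ (ι ⊕ κ) where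
  toFun x := WithLp.toLp 2 (Sum.elim x.ofLp 0)
  map_add' x y := by ext (i | i) <;> simp
  map_smul' a x := by ext (i | i) <;> simp

/-- The inclusion of the second summand of `ℂ^ι ⊕ ℂ^κ`. -/
def inrLin (ι κ : Type*) : EuclideanSpace ℂ κ →ₗ[ℂ] EuclideanSpace ℂ (ι ⊕ κ) where
  toFun x := WithLp.toLp 2 (Sum.elim 0 x.ofLp)
  map_add' x y := by ext (i | i) <;> simp
  map_smul' a x := by ext (i | i) <;> simp

/-- The projection of `ℂ^ι ⊕ ℂ^κ` to the first summand. -/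
def fstLin (ι κ : Type*) : EuclideanSpace ℂ (ι ⊕ κ) →ₗ[ℂ] EuclideanSpace ℂ ι where
  toFun x := WithLp.toLp 2 (x.ofLp ∘ Sum.inl)
  map_add' x y := by ext i; simp
  map_smul' a x := by ext i; simp

/-- The projection of `ℂ^ι ⊕ ℂ^κ` to the second summand. -/
def sndLin (ι κ : Type*) : EuclideanSpace ℂ (ι ⊕ κ) →ₗ[ℂ] EuclideanSpace ℂ κ where
  toFun x := WithLp.toLp 2 (x.ofLp ∘ Sum.inr)
  map_add' x y := by ext i; simp
  map_smul' a x := by ext i; simp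

@[simp] theorem fstLin_inlLin (x : EuclideanSpace ℂ ι) : fstLin ι κ (inlLin ι κ x) = x := rfl

@[simp] theorem sndLin_inrLin (x : EuclideanSpace ℂ κ) : sndLin ι κ (inrLin ι κ x) = x := rfl

@[simp] theorem sndLin_inlLin (x : EuclideanSpace ℂ ι) : sndLin ι κ (inlLin ι κ x) = 0 := rfl

@[simp] theorem fstLin_inrLin (x : EuclideanSpace ℂ κ) : fstLin ι κ (inrLin ι κ x) = 0 := rfl

theorem inlLin_add_inrLin (x : EuclideanSpace ℂ (ι ⊕ κ)) :
    inlLin ι κ (fstLin ι κ x) + inrLin ι κ (sndLin ι κ x) = x := by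
  ext (i | i) <;> simp [inlLin, inrLin, fstLin, sndLin]

theorem sum_ext {x y : EuclideanSpace ℂ (ι ⊕ κ)} (h1 : fstLin ι κ x = fstLin ι κ y)
    (h2 : sndLin ι κ x = sndLin ι κ y) : x = y := by
  rw [← inlLin_add_inrLin x, h1, h2, inlLin_add_inrLin]

theorem inlLin_injective : Function.Injective (inlLin ι κ) :=
  Function.LeftInverse.injective fstLin_inlLin

theorem inrLin_injective : Function.Injective (inrLin ι κ) :=
  Function.LeftInverse.injective sndLin_inrLin

theorem mem_range_inrLin {x : EuclideanSpace ℂ (ι ⊕ κ)} :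
    x ∈ (inrLin ι κ).range ↔ fstLin ι κ x = 0 := by
  constructor
  · rintro ⟨y, rfl⟩
    simp
  · intro h
    exact ⟨sndLin ι κ x, sum_ext (by simp [h]) (by simp)⟩

theorem mem_map_inlLin {S : Submodule ℂ (EuclideanSpace ℂ ι)} {x : EuclideanSpace ℂ (ι ⊕ κ)} :
    x ∈ S.map (inlLin ι κ) ↔ fstLin ι κ x ∈ S ∧ sndLin ι κ x = 0 := by
  constructor
  · rintro ⟨y, hy, rfl⟩
    simpa using hy
  · rintro ⟨h, h'⟩
    exact ⟨_, h, sum_ext (by simp) (by simp [h'])⟩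

theorem mem_map_inlLin_sup {S : Submodule ℂ (EuclideanSpace ℂ ι)} {x : EuclideanSpace ℂ (ι ⊕ κ)} :
    x ∈ S.map (inlLin ι κ) ⊔ (inrLin ι κ).range ↔ fstLin ι κ x ∈ S := by
  constructor
  · intro h
    obtain ⟨a, ha, b, hb, rfl⟩ := Submodule.mem_sup.1 h
    rw [map_add, mem_range_inrLin.1 hb, add_zero]
    exact (mem_map_inlLin.1 ha).1
  · intro h
    rw [← inlLin_add_inrLin x]
    exact Submodule.add_mem_sup (Submodule.mem_map_of_mem h) ⟨_, rfl⟩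

theorem map_inlLin_inf_range {S : Submodule ℂ (EuclideanSpace ℂ ι)} :
    S.map (inlLin ι κ) ⊓ (inrLin ι κ).range = ⊥ := by
  rw [Submodule.eq_bot_iff]
  rintro x ⟨h, h'⟩
  exact sum_ext (mem_range_inrLin.1 h') (mem_map_inlLin.1 h).2

theorem finrank_range_inrLin [Fintype κ] : finrank ℂ (inrLin ι κ).range = Fintype.card κ := by
  rw [LinearMap.finrank_range_of_inj inrLin_injective, finrank_euclideanSpace]

variable [Fintype ι] [Fintype κ]

theorem inner_sum (x y : EuclideanSpace ℂ (ι ⊕ κ)) :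
    inner ℂ x y = inner ℂ (fstLin ι κ x) (fstLin ι κ y) + inner ℂ (sndLin ι κ x) (sndLin ι κ y) := by
  simp [PiLp.inner_apply, fstLin, sndLin]

variable [DecidableEq ι] [DecidableEq κ]

theorem fstLin_fromBlocks (a : Matrix ι ι ℂ) (b : Matrix ι κ ℂ) (c : Matrix κ ι ℂ)
    (d : Matrix κ κ ℂ) (x : EuclideanSpace ℂ (ι ⊕ κ)) :
    fstLin ι κ (toEuclideanLin (fromBlocks a b c d) x) =
      toEuclideanLin a (fstLin ι κ x) + toEuclideanLin b (sndLin ι κ x) := by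
  ext i
  simp [toLpLin_apply, fromBlocks_mulVec, fstLin, sndLin]

theorem sndLin_fromBlocks (a : Matrix ι ι ℂ) (b : Matrix ι κ ℂ) (c : Matrix κ ι ℂ)
    (d : Matrix κ κ ℂ) (x : EuclideanSpace ℂ (ι ⊕ κ)) :
    sndLin ι κ (toEuclideanLin (fromBlocks a b c d) x) =
      toEuclideanLin c (fstLin ι κ x) + toEuclideanLin d (sndLin ι κ x) := by
  ext i
  simp [toLpLin_apply, fromBlocks_mulVec, fstLin, sndLin]

theorem quadForm_inlLin (a : Matrix ι ι ℂ) (b : Matrix ι κ ℂ) (c : Matrix κ ι ℂ)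
    (d : Matrix κ κ ℂ) (x : EuclideanSpace ℂ ι) :
    quadForm (toEuclideanLin (fromBlocks a b c d)) (inlLin ι κ x) =
      quadForm (toEuclideanLin a) x := by
  rw [quadForm, inner_sum, fstLin_fromBlocks, sndLin_fromBlocks]
  simp [quadForm]

theorem posIndex_map_inlLin (a : Matrix ι ι ℂ) (b : Matrix ι κ ℂ) (c : Matrix κ ι ℂ)
    (d : Matrix κ κ ℂ) (S : Submodule ℂ (EuclideanSpace ℂ ι)) :
    posIndex (toEuclideanLin (fromBlocks a b c d)) (S.map (inlLin ι κ)) =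
      posIndex (toEuclideanLin a) S :=
  posIndex_map inlLin_injective (quadForm_inlLin a b c d) S

/-- Inertia of a bordered Hermitian matrix. -/
theorem posIndex_fromBlocks_zero {a : Matrix ι ι ℂ} (ha : a.IsHermitian) (b : Matrix ι κ ℂ) :
    posIndex (toEuclideanLin (fromBlocks a b bᴴ 0)) ⊤ =
      b.rank + posIndex (toEuclideanLin a) (toEuclideanLin bᴴ).ker := by
  have hT := isSymmetric_toEuclideanLin (ha.fromBlocks (B := b) rfl isHermitian_zero)
  set T := toEuclideanLin (fromBlocks a b bᴴ 0)
  set N := (inrLin ι κ).range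
  have hz : ∀ x ∈ N, quadForm T x = 0 := by
    intro x hx
    have h1 := mem_range_inrLin.1 hx
    rw [quadForm, inner_sum, sndLin_fromBlocks, h1]
    simp
  have hN : NonposOn T N := fun x hx => (hz x hx).le
  have hNN := le_formPerp_self hT hz
  -- Decompose along the totally isotropic summand `N`: its radical part is `ker b` and `N^⊥ = ker
  -- b* ⊕ N`, so `dim N - dim ker b = r(b)` is the extra term.
  have h1 := posIndex_decomposition hT (le_top : N ≤ ⊤)
  have h2 : N ⊓ formPerp T ⊤ = (toEuclideanLin b).ker.map (inrLin ι κ) := by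
    ext x
    rw [Submodule.mem_inf, mem_formPerp_top hT]
    constructor
    · rintro ⟨⟨y, rfl⟩, h⟩
      refine ⟨y, ?_, rfl⟩
      have := congrArg (fstLin ι κ) h
      rw [fstLin_fromBlocks] at this
      simpa using this
    · rintro ⟨y, hy, rfl⟩
      refine ⟨⟨y, rfl⟩, sum_ext ?_ ?_⟩
      · rw [fstLin_fromBlocks]
        simpa using hy
      · rw [sndLin_fromBlocks]
        simp
  have h3 : formPerp T N = (toEuclideanLin bᴴ).ker.map (inlLin ι κ) ⊔ N := by
    ext x
    rw [mem_map_inlLin_sup, mem_formPerp, LinearMap.mem_ker]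
    have key : ∀ y, inner ℂ (T (inrLin ι κ y)) x =
        inner ℂ y (toEuclideanLin bᴴ (fstLin ι κ x)) := fun y => by
      rw [inner_sum, fstLin_fromBlocks, sndLin_fromBlocks, ← inner_toEuclideanLin]
      simp
    constructor
    · intro h
      refine ext_inner_left ℂ fun y => ?_
      rw [← key, h _ ⟨y, rfl⟩, inner_zero_right]
    · rintro h _ ⟨y, rfl⟩
      rw [key, h, inner_zero_right]
  have h4 : (toEuclideanLin bᴴ).ker.map (inlLin ι κ) ≤ formPerp T N := h3 ▸ le_sup_left
  have h5 := posIndex_sup_of_orthogonal_nonpos hT ((le_formPerp_comm hT).1 h4) hN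
  have h6 := rank_add_finrank_ker b
  have h7 : finrank ℂ N = Fintype.card κ := finrank_range_inrLin
  rw [posIndex_map_inlLin] at h5
  rw [inf_top_eq, inf_eq_left.2 hNN, h2, h3, h5, finrank_map_of_injective inrLin_injective,
    posIndex_eq_zero hN] at h1
  omega

end Blocks

/-! ### Ranks of the block matrices as dimensions attached to `K`, `U` and the form -/

section Ranks

variable {ι κ μ : Type*} [Fintype ι] [Fintype μ]

theorem sumElim_eq_zero {α β γ : Type*} [Zero γ] {f : α → γ} {g : β → γ} :
    Sum.elim f g = 0 ↔ f = 0 ∧ g = 0 := by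
  simp [funext_iff]

theorem finrank_eq_of_map_fstLin (Q : Submodule ℂ (EuclideanSpace ℂ (ι ⊕ μ)))
    {S : Submodule ℂ (EuclideanSpace ℂ μ)} (h : ∀ y, inrLin ι μ y ∈ Q ↔ y ∈ S) :
    finrank ℂ Q = finrank ℂ ↥(Q.map (fstLin ι μ)) + finrank ℂ S := by
  have h1 := ((fstLin ι μ).domRestrict Q).finrank_range_add_finrank_ker
  have h2 : ((fstLin ι μ).domRestrict Q).range = Q.map (fstLin ι μ) := by
    ext x
    simp
  have h3 : ((fstLin ι μ).domRestrict Q).ker.map Q.subtype = S.map (inrLin ι μ) := by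
    ext x
    constructor
    · rintro ⟨⟨y, hy⟩, hy', rfl⟩
      obtain ⟨z, rfl⟩ := mem_range_inrLin.2 (show fstLin ι μ y = 0 from hy')
      exact ⟨z, (h z).1 hy, rfl⟩
    · rintro ⟨y, hy, rfl⟩
      exact ⟨⟨_, (h y).2 hy⟩, rfl, rfl⟩
  rw [← h1, h2, ← finrank_map_of_injective (inrLin_injective (ι := ι)) S, ← h3,
    Submodule.finrank_map_subtype_eq]

variable [DecidableEq ι] [Fintype κ] [DecidableEq κ]

variable {a : Matrix ι ι ℂ} {g : Matrix κ κ ℂ}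

theorem rank_add_finrank_radical (ha : a.IsHermitian) (b : Matrix ι κ ℂ) (hg : g.IsHermitian)
    (A : Matrix ι μ ℂ) :
    (fromCols (fromCols a b) A).rank +
      finrank ℂ ↥((toEuclideanLin Aᴴ).ker.map (inlLin ι κ) ⊓
        formPerp (toEuclideanLin (fromBlocks a b bᴴ g)) ⊤) = Fintype.card ι := by
  have hT := isSymmetric_toEuclideanLin (ha.fromBlocks (B := b) rfl hg)
  have h : (toEuclideanLin Aᴴ).ker.map (inlLin ι κ) ⊓
      formPerp (toEuclideanLin (fromBlocks a b bᴴ g)) ⊤ =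
      (toEuclideanLin (fromCols (fromCols a b) A)ᴴ).ker.map (inlLin ι κ) := by
    have key : ∀ y : EuclideanSpace ℂ ι, y ∈ (toEuclideanLin (fromCols (fromCols a b) A)ᴴ).ker ↔
        toEuclideanLin Aᴴ y = 0 ∧
          toEuclideanLin (fromBlocks a b bᴴ g) (inlLin ι κ y) = 0 := fun y => by
      rw [mem_ker_toEuclideanLin, conjTranspose_fromCols_eq_fromRows_conjTranspose,
        conjTranspose_fromCols_eq_fromRows_conjTranspose, fromRows_mulVec, fromRows_mulVec,
        sumElim_eq_zero, sumElim_eq_zero, ha.eq, and_comm, ← LinearMap.mem_ker,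
        mem_ker_toEuclideanLin, ← LinearMap.mem_ker, mem_ker_toEuclideanLin,
        fromBlocks_mulVec, sumElim_eq_zero]
      rw [show (inlLin ι κ y).ofLp ∘ Sum.inl = y.ofLp from rfl,
        show (inlLin ι κ y).ofLp ∘ Sum.inr = 0 from rfl]
      simp only [mulVec_zero, add_zero]
    ext x
    rw [Submodule.mem_inf, mem_formPerp_top hT]
    constructor
    · rintro ⟨⟨y, hy, rfl⟩, hx⟩
      exact ⟨y, (key y).2 ⟨hy, hx⟩, rfl⟩
    · rintro ⟨y, hy, rfl⟩
      exact ⟨⟨y, ((key y).1 hy).1, rfl⟩, ((key y).1 hy).2⟩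
  rw [h, finrank_map_of_injective inlLin_injective, rank_add_finrank_ker_conjTranspose]

theorem rank_add_finrank_radical_inf (ha : a.IsHermitian) (b : Matrix ι κ ℂ) (hg : g.IsHermitian)
    (A : Matrix ι μ ℂ) :
    (fromRows (fromCols (fromCols a b) A) (fromCols (fromCols bᴴ g) 0)).rank +
      finrank ℂ ↥(formPerp (toEuclideanLin (fromBlocks a b bᴴ g)) ⊤ ⊓
        ((toEuclideanLin Aᴴ).ker.map (inlLin ι κ) ⊔ (inrLin ι κ).range)) =
      Fintype.card ι + Fintype.card κ := by
  have hT := isSymmetric_toEuclideanLin (ha.fromBlocks (B := b) rfl hg)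
  have h : formPerp (toEuclideanLin (fromBlocks a b bᴴ g)) ⊤ ⊓
        ((toEuclideanLin Aᴴ).ker.map (inlLin ι κ) ⊔ (inrLin ι κ).range) =
      (toEuclideanLin (fromRows (fromCols (fromCols a b) A)
        (fromCols (fromCols bᴴ g) 0))ᴴ).ker := by
    ext x
    rw [Submodule.mem_inf, mem_formPerp_top hT, mem_map_inlLin_sup, mem_ker_toEuclideanLin,
      mem_ker_toEuclideanLin, ← LinearMap.mem_ker, mem_ker_toEuclideanLin]
    simp only [conjTranspose_fromCols_eq_fromRows_conjTranspose,
      conjTranspose_fromRows_eq_fromCols_conjTranspose, fromRows_mulVec, fromCols_mulVec,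
      fromBlocks_mulVec, ← Sum.elim_add_add, sumElim_eq_zero, ha.eq, hg.eq,
      conjTranspose_conjTranspose, conjTranspose_zero, zero_mulVec, add_zero]
    rfl
  rw [h, rank_add_finrank_ker_conjTranspose, Fintype.card_sum]

/-- A vector `(y, 0)` is orthogonal to `ker A* ⊕ ℂ^κ` iff `b* y = 0` and `a y ∈ (ker A*)ᗮ = range
A`. The kernel of the adjoint block matrix consists of pairs `(y, z)` with `a y + A z = 0`, `b* y =
0`, `A* y = 0`; forgetting `z` loses a copy of `ker A`, whence the term `r(A)`. -/
theorem rank_add_finrank_inf_formPerp [DecidableEq μ] (ha : a.IsHermitian) (b : Matrix ι κ ℂ) (hg : g.IsHermitian)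
    (A : Matrix ι μ ℂ) :
    (fromRows (fromCols (fromCols a b) A) (fromCols (fromCols Aᴴ 0) 0)).rank +
      finrank ℂ ↥((toEuclideanLin Aᴴ).ker.map (inlLin ι κ) ⊓
        formPerp (toEuclideanLin (fromBlocks a b bᴴ g))
          ((toEuclideanLin Aᴴ).ker.map (inlLin ι κ) ⊔ (inrLin ι κ).range)) =
      Fintype.card ι + A.rank := by
  have hT := isSymmetric_toEuclideanLin (ha.fromBlocks (B := b) rfl hg)
  set N : Matrix (ι ⊕ μ) ((ι ⊕ κ) ⊕ μ) ℂ :=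
    fromRows (fromCols (fromCols a b) A) (fromCols (fromCols Aᴴ 0) 0) with hN
  set T := toEuclideanLin (fromBlocks a b bᴴ g)
  set Q := (toEuclideanLin Nᴴ).ker with hQ
  have memQ : ∀ x, x ∈ Q ↔
      (toEuclideanLin a (fstLin ι μ x) + toEuclideanLin A (sndLin ι μ x) = 0 ∧
        toEuclideanLin bᴴ (fstLin ι μ x) = 0) ∧ toEuclideanLin Aᴴ (fstLin ι μ x) = 0 := by
    intro x
    rw [hQ, mem_ker_toEuclideanLin, hN]
    simp only [conjTranspose_fromCols_eq_fromRows_conjTranspose,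
      conjTranspose_fromRows_eq_fromCols_conjTranspose, fromRows_mulVec, fromCols_mulVec,
      ← Sum.elim_add_add, sumElim_eq_zero, ha.eq,
      conjTranspose_conjTranspose, conjTranspose_zero, zero_mulVec, add_zero]
    simp only [toLpLin_apply, ← WithLp.toLp_add, WithLp.toLp_eq_zero]
    rfl
  have h1 := finrank_eq_of_map_fstLin Q (S := (toEuclideanLin A).ker) fun y => by
    rw [memQ]; simp
  have h2 : (toEuclideanLin Aᴴ).ker.map (inlLin ι κ) ⊓ formPerp T
      ((toEuclideanLin Aᴴ).ker.map (inlLin ι κ) ⊔ (inrLin ι κ).range) =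
      (Q.map (fstLin ι μ)).map (inlLin ι κ) := by
    have key : ∀ y : EuclideanSpace ℂ ι,
        inlLin ι κ y ∈ formPerp T ((toEuclideanLin Aᴴ).ker.map (inlLin ι κ) ⊔ (inrLin ι κ).range) ↔
          toEuclideanLin a y ∈ (toEuclideanLin A).range ∧ toEuclideanLin bᴴ y = 0 := by
      intro y
      rw [← ker_conjTranspose_orthogonal, Submodule.mem_orthogonal, mem_formPerp]
      have hin : ∀ w, inner ℂ (T w) (inlLin ι κ y) =
          inner ℂ (fstLin ι κ w) (toEuclideanLin a y) +
            inner ℂ (sndLin ι κ w) (toEuclideanLin bᴴ y) := fun w => by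
        rw [hT, inner_sum, fstLin_fromBlocks, sndLin_fromBlocks]
        simp
      constructor
      · intro h
        constructor
        · intro u hu
          have := h (inlLin ι κ u) (mem_map_inlLin_sup.2 (by simpa using hu))
          rw [hin] at this
          simpa using this
        · refine ext_inner_left ℂ fun u => ?_
          have := h (inrLin ι κ u) (mem_map_inlLin_sup.2 (by simp))
          rw [hin] at this
          simpa using this
      · rintro ⟨h, h'⟩ w hw
        rw [hin, h', inner_zero_right, add_zero]
        exact h _ (mem_map_inlLin_sup.1 hw)
    ext x
    constructor
    · rintro ⟨⟨y, hy, rfl⟩, hx⟩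
      obtain ⟨⟨z, hz⟩, hb⟩ := (key y).1 hx
      refine ⟨y, ⟨inlLin ι μ y + inrLin ι μ (-z), (memQ _).2 ⟨⟨?_, ?_⟩, ?_⟩, ?_⟩, rfl⟩
      · simp only [map_add, fstLin_inlLin, fstLin_inrLin, sndLin_inlLin, sndLin_inrLin, map_neg,
          hz, add_zero, zero_add, neg_zero]
        exact add_neg_cancel _
      · simpa using hb
      · simpa using hy
      · simp
    · rintro ⟨_, ⟨z, hz, rfl⟩, rfl⟩
      obtain ⟨⟨ha', hb⟩, hA⟩ := (memQ z).1 hz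
      refine ⟨⟨_, hA, rfl⟩, (key _).2 ⟨⟨-sndLin ι μ z, ?_⟩, hb⟩⟩
      rw [map_neg, ← eq_neg_of_add_eq_zero_left ha']
  have h3 := rank_add_finrank_ker_conjTranspose N
  have h4 := rank_add_finrank_ker A
  rw [← hQ, Fintype.card_sum] at h3
  rw [h2, finrank_map_of_injective inlLin_injective]
  omega

end Ranks

/-! ### Graphs of `(AX)*` as complements of `U` containing `K` -/

section Graph

variable {ι κ μ : Type*} [Fintype ι] [DecidableEq ι]

/-- The block column `[1; L]` parametrizes the graph of `L`. -/
theorem toEuclideanLin_fromRows_one (L : Matrix κ ι ℂ) (x : EuclideanSpace ℂ ι) :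
    toEuclideanLin (fromRows (1 : Matrix ι ι ℂ) L) x =
      inlLin ι κ x + inrLin ι κ (toEuclideanLin L x) := by
  ext (i | i) <;> simp [toLpLin_apply, fromRows_mulVec, inlLin, inrLin]

theorem exists_comp_eq_of_ker_le {V₁ V₂ V₃ : Type*} [AddCommGroup V₁] [Module ℂ V₁]
    [AddCommGroup V₂] [Module ℂ V₂] [AddCommGroup V₃] [Module ℂ V₃] (f : V₁ →ₗ[ℂ] V₂)
    (g : V₁ →ₗ[ℂ] V₃) (h : f.ker ≤ g.ker) : ∃ k : V₂ →ₗ[ℂ] V₃, ∀ x, k (f x) = g x := by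
  obtain ⟨k, hk⟩ := LinearMap.exists_extend
    ((f.ker.liftQ g h) ∘ₗ (f.quotKerEquivRange.symm : f.range →ₗ[ℂ] V₁ ⧸ f.ker))
  refine ⟨k, fun x => ?_⟩
  have h1 := LinearMap.congr_fun hk ⟨f x, x, rfl⟩
  have h2 : f.quotKerEquivRange.symm ⟨f x, x, rfl⟩ = f.ker.mkQ x := by
    rw [LinearEquiv.symm_apply_eq]
    rfl
  simpa [h2] using h1

theorem graph_injective (L : Matrix κ ι ℂ) :
    Function.Injective (toEuclideanLin (fromRows (1 : Matrix ι ι ℂ) L)) := by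
  refine Function.LeftInverse.injective (g := fstLin ι κ) fun x => ?_
  rw [toEuclideanLin_fromRows_one]
  simp

theorem graph_inf_range (L : Matrix κ ι ℂ) :
    (toEuclideanLin (fromRows (1 : Matrix ι ι ℂ) L)).range ⊓ (inrLin ι κ).range = ⊥ := by
  rw [Submodule.eq_bot_iff]
  rintro _ ⟨⟨x, rfl⟩, h⟩
  have := mem_range_inrLin.1 h
  rw [toEuclideanLin_fromRows_one] at this
  rw [show x = 0 by simpa using this, map_zero]

theorem graph_sup_range (L : Matrix κ ι ℂ) :
    (toEuclideanLin (fromRows (1 : Matrix ι ι ℂ) L)).range ⊔ (inrLin ι κ).range = ⊤ := by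
  rw [eq_top_iff]
  intro x _
  refine Submodule.mem_sup.2 ⟨_, ⟨fstLin ι κ x, rfl⟩,
    _, ⟨sndLin ι κ x - toEuclideanLin L (fstLin ι κ x), rfl⟩, ?_⟩
  rw [toEuclideanLin_fromRows_one]
  exact sum_ext (by simp) (by simp)

theorem posIndex_graph [Fintype κ] [DecidableEq κ] (H : Matrix (ι ⊕ κ) (ι ⊕ κ) ℂ) (L : Matrix κ ι ℂ) :
    posIndex (toEuclideanLin H) (toEuclideanLin (fromRows (1 : Matrix ι ι ℂ) L)).range =
      posIndex
        (toEuclideanLin ((fromRows (1 : Matrix ι ι ℂ) L)ᴴ * H * fromRows (1 : Matrix ι ι ℂ) L)) ⊤ := by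
  rw [LinearMap.range_eq_map]
  exact posIndex_map (graph_injective L) (fun x => (quadForm_conjTranspose_mul_mul _ H x).symm) ⊤

variable [Fintype μ] [DecidableEq μ]

theorem ker_le_graph (A : Matrix ι μ ℂ) (X : Matrix μ κ ℂ) :
    (toEuclideanLin Aᴴ).ker.map (inlLin ι κ) ≤
      (toEuclideanLin (fromRows (1 : Matrix ι ι ℂ) (A * X)ᴴ)).range := by
  rintro _ ⟨x, hx, rfl⟩
  refine ⟨x, ?_⟩
  rw [toEuclideanLin_fromRows_one, conjTranspose_mul, toLpLin_mul_same, LinearMap.comp_apply,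
    LinearMap.mem_ker.1 hx, map_zero, map_zero, add_zero]

/-- A complement of `0 ⊕ ℂ^κ` is the graph of a linear map. Containing `ker A* ⊕ 0` means that this
map vanishes on `ker A*`, so it factors as `k ∘ A*`, and `X = k*`. -/
theorem exists_eq_graph (A : Matrix ι μ ℂ) {W : Submodule ℂ (EuclideanSpace ℂ (ι ⊕ κ))}
    (hK : (toEuclideanLin Aᴴ).ker.map (inlLin ι κ) ≤ W) (hinf : W ⊓ (inrLin ι κ).range = ⊥)
    (hsup : W ⊔ (inrLin ι κ).range = ⊤) :
    ∃ X : Matrix μ κ ℂ, (toEuclideanLin (fromRows (1 : Matrix ι ι ℂ) (A * X)ᴴ)).range = W := by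
  have hc : IsCompl W (inrLin ι κ).range := ⟨disjoint_iff.2 hinf, codisjoint_iff.2 hsup⟩
  -- `P` is the projection onto `W` along `0 ⊕ ℂ^κ`; it preserves first components, so `x ↦ snd (P
  -- (x, 0))` is the map whose graph is `W`.
  set P := W.subtype ∘ₗ W.projectionOnto _ hc
  have hPW : ∀ x, P x ∈ W := fun x => (W.projectionOnto _ hc x).2
  have hP : ∀ x ∈ W, P x = x := fun x hx =>
    congrArg Subtype.val (Submodule.projectionOnto_apply_left hc ⟨x, hx⟩)
  have hPfst : ∀ x, fstLin ι κ (P x) = fstLin ι κ x := fun x => by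
    have h1 : W.projectionOnto _ hc (P x - x) = 0 := by
      rw [map_sub, sub_eq_zero]
      exact Submodule.projectionOnto_apply_left hc _
    have h2 := mem_range_inrLin.1 ((Submodule.projectionOnto_apply_eq_zero_iff hc).1 h1)
    rwa [map_sub, sub_eq_zero] at h2
  obtain ⟨k, hk⟩ := exists_comp_eq_of_ker_le (toEuclideanLin Aᴴ)
    (sndLin ι κ ∘ₗ P ∘ₗ inlLin ι κ) fun x hx => by
      rw [LinearMap.mem_ker, LinearMap.comp_apply, LinearMap.comp_apply,
        hP _ (hK (Submodule.mem_map_of_mem hx)), sndLin_inlLin]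
  refine ⟨(toEuclideanLin.symm k)ᴴ, ?_⟩
  set J := toEuclideanLin (fromRows (1 : Matrix ι ι ℂ) (A * (toEuclideanLin.symm k)ᴴ)ᴴ)
  have hJ : ∀ x, J x = P (inlLin ι κ x) := fun x => by
    rw [toEuclideanLin_fromRows_one, conjTranspose_mul, conjTranspose_conjTranspose,
      toLpLin_mul_same, LinearEquiv.apply_symm_apply, LinearMap.comp_apply, hk]
    exact sum_ext (by simp [hPfst]) (by simp)
  apply le_antisymm
  · rintro _ ⟨x, rfl⟩
    rw [hJ]
    exact hPW _
  · intro w hw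
    refine ⟨fstLin ι κ w, ?_⟩
    rw [hJ, ← sub_eq_zero]
    have : P (inlLin ι κ (fstLin ι κ w)) - w ∈ W ⊓ (inrLin ι κ).range :=
      ⟨W.sub_mem (hPW _) hw, mem_range_inrLin.2 (by rw [map_sub, hPfst]; simp)⟩
    rwa [hinf, Submodule.mem_bot] at this

end Graph

/-! ### Translation of the bounds into the matrices `N₀, …, N₄` -/

section Assembly

theorem neg_fromBlocks_eq {ι κ : Type*} (a : Matrix ι ι ℂ) (b : Matrix ι κ ℂ) (c : Matrix κ κ ℂ) :
    -fromBlocks a b bᴴ c = fromBlocks (-a) (-b) (-b)ᴴ (-c) := by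
  rw [fromBlocks_neg, conjTranspose_neg]

theorem ker_toEuclideanLin_neg {ι κ : Type*} [Fintype ι] [DecidableEq ι] (M : Matrix κ ι ℂ) :
    (toEuclideanLin (-M)).ker = (toEuclideanLin M).ker := by
  ext x
  simp

theorem rank_neg_complex {ι κ : Type*} [Fintype ι] [Fintype κ] [DecidableEq ι]
    (M : Matrix κ ι ℂ) : (-M).rank = M.rank := by
  have h1 := rank_add_finrank_ker M
  have h2 := rank_add_finrank_ker (-M)
  rw [ker_toEuclideanLin_neg] at h2
  omega

variable {n p m q : ℕ}

/-- The kernel of `A*`, as a subspace of `ℂⁿ ⊕ ℂᵐ`. -/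
noncomputable def kerSpace (m : ℕ) (A : Matrix (Fin n) (Fin p) ℂ) :
    Submodule ℂ (EuclideanSpace ℂ (Fin n ⊕ Fin m)) :=
  (toEuclideanLin Aᴴ).ker.map (inlLin (Fin n) (Fin m))

/-- The graph of `(A X)*`, as a subspace of `ℂⁿ ⊕ ℂᵐ`. -/
noncomputable def graphSpace (A : Matrix (Fin n) (Fin p) ℂ) (X : Matrix (Fin p) (Fin m) ℂ) :
    Submodule ℂ (EuclideanSpace ℂ (Fin n ⊕ Fin m)) :=
  (toEuclideanLin (fromRows (1 : Matrix (Fin n) (Fin n) ℂ) (A * X)ᴴ)).range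

variable (A : Matrix (Fin n) (Fin p) ℂ) (B : Matrix (Fin m) (Fin q) ℂ)
    (C : Matrix (Fin n) (Fin q) ℂ) {M : Matrix (Fin q) (Fin q) ℂ}
    {D : Matrix (Fin n) (Fin n) ℂ}

theorem phi_eq_graph (M : Matrix (Fin q) (Fin q) ℂ) (D : Matrix (Fin n) (Fin n) ℂ)
    (X : Matrix (Fin p) (Fin m) ℂ) :
    phi A B C M D X = (fromRows (1 : Matrix (Fin n) (Fin n) ℂ) (A * X)ᴴ)ᴴ * N3 B C M D *
      fromRows (1 : Matrix (Fin n) (Fin n) ℂ) (A * X)ᴴ := by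
  rw [phi, N3, conjTranspose_fromRows_eq_fromCols_conjTranspose, fromCols_mul_fromBlocks,
    fromCols_mul_fromRows]
  simp only [conjTranspose_add, conjTranspose_mul, conjTranspose_conjTranspose,
    conjTranspose_one, Matrix.one_mul, Matrix.mul_one, Matrix.add_mul, Matrix.mul_add,
    Matrix.mul_assoc]
  abel

theorem N3_eq (hM : M.IsHermitian) (D : Matrix (Fin n) (Fin n) ℂ) :
    N3 B C M D = fromBlocks (D + C * M * Cᴴ) (C * M * Bᴴ) (C * M * Bᴴ)ᴴ (B * M * Bᴴ) := by
  rw [N3, conjTranspose_mul, conjTranspose_mul, conjTranspose_conjTranspose, hM.eq,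
    Matrix.mul_assoc B M Cᴴ]

theorem posInertia_phi (hM : M.IsHermitian) (hD : D.IsHermitian) (X : Matrix (Fin p) (Fin m) ℂ) :
    posInertia (phi A B C M D X) (phi_isHermitian A B C hM hD X) =
      posIndex (toEuclideanLin (N3 B C M D)) (graphSpace A X) := by
  rw [posInertia_eq_posIndex, graphSpace, posIndex_graph, phi_eq_graph]

theorem negInertia_phi (hM : M.IsHermitian) (hD : D.IsHermitian) (X : Matrix (Fin p) (Fin m) ℂ) :
    negInertia (phi A B C M D X) (phi_isHermitian A B C hM hD X) =
      posIndex (-toEuclideanLin (N3 B C M D)) (graphSpace A X) := by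
  rw [negInertia_eq_posIndex, ← map_neg, ← map_neg, graphSpace, posIndex_graph, phi_eq_graph,
    Matrix.mul_neg, Matrix.neg_mul]

theorem posInertia_N1 (hM : M.IsHermitian) (hD : D.IsHermitian) :
    posInertia _ (N1_isHermitian A C hM hD) =
      A.rank + posIndex (toEuclideanLin (N3 B C M D)) (kerSpace m A) := by
  rw [posInertia_eq_posIndex, N1, N3, kerSpace, posIndex_map_inlLin, posIndex_fromBlocks_zero]
  exact hD.add (isHermitian_mul_mul_conjTranspose _ hM)

theorem negInertia_N1 (hM : M.IsHermitian) (hD : D.IsHermitian) :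
    negInertia _ (N1_isHermitian A C hM hD) =
      A.rank + posIndex (-toEuclideanLin (N3 B C M D)) (kerSpace m A) := by
  rw [negInertia_eq_posIndex, ← map_neg, ← map_neg, N1, N3_eq B C hM, kerSpace,
    neg_fromBlocks_eq, neg_fromBlocks_eq, posIndex_map_inlLin, neg_zero,
    posIndex_fromBlocks_zero, rank_neg_complex, conjTranspose_neg, ker_toEuclideanLin_neg]
  exact (hD.add (isHermitian_mul_mul_conjTranspose _ hM)).neg

/-- Apart from the indices, the bound depends on `T` only through orthogonality. Hypothesis `hT`
therefore lets one statement serve both `N₃` and `-N₃`. -/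
theorem minPosIndex_eq (hM : M.IsHermitian) (hD : D.IsHermitian)
    {T : EuclideanSpace ℂ (Fin n ⊕ Fin m) →ₗ[ℂ] EuclideanSpace ℂ (Fin n ⊕ Fin m)}
    (hT : ∀ W, formPerp T W = formPerp (toEuclideanLin (N3 B C M D)) W) :
    minPosIndex T (inrLin (Fin n) (Fin m)).range (kerSpace m A) =
      (N0 A B C M D).rank + max
        ((A.rank + posIndex T (kerSpace m A) : ℕ) - (N2 A B C M D).rank : ℤ)
        (posIndex T ⊤ - (N4 A B C M D).rank) := by
  have ha : (D + C * M * Cᴴ).IsHermitian := hD.add (isHermitian_mul_mul_conjTranspose _ hM)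
  have hg : (B * M * Bᴴ).IsHermitian := isHermitian_mul_mul_conjTranspose _ hM
  have h0 := rank_add_finrank_radical ha (C * M * Bᴴ) hg A
  have h2 := rank_add_finrank_inf_formPerp ha (C * M * Bᴴ) hg A
  have h4 := rank_add_finrank_radical_inf ha (C * M * Bᴴ) hg A
  rw [← N3_eq B C hM, ← hT, ← kerSpace, Fintype.card_fin] at h0 h2 h4
  rw [Fintype.card_fin] at h4
  have hU := finrank_range_inrLin (ι := Fin n) (κ := Fin m)
  rw [Fintype.card_fin] at hU
  have e4 : (C * M * Bᴴ)ᴴ = B * M * Cᴴ := by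
    rw [conjTranspose_mul, conjTranspose_mul, conjTranspose_conjTranspose, hM.eq,
      Matrix.mul_assoc]
  rw [e4] at h4
  rw [minPosIndex, N0, N2, N4]
  omega

theorem finrank_kerSpace : A.rank + finrank ℂ (kerSpace m A) = n := by
  rw [kerSpace, finrank_map_of_injective inlLin_injective, rank_add_finrank_ker_conjTranspose,
    Fintype.card_fin]

theorem maxPosIndex_eq {T : EuclideanSpace ℂ (Fin n ⊕ Fin m) →ₗ[ℂ] EuclideanSpace ℂ (Fin n ⊕ Fin m)} :
    maxPosIndex T (inrLin (Fin n) (Fin m)).range (kerSpace m A) =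
      min ((A.rank + posIndex T (kerSpace m A) : ℕ) : ℤ) (posIndex T ⊤) := by
  have h1 := finrank_kerSpace (m := m) A
  have hU := finrank_range_inrLin (ι := Fin n) (κ := Fin m)
  have hE := finrank_euclideanSpace (𝕜 := ℂ) (ι := Fin n ⊕ Fin m)
  rw [Fintype.card_sum, Fintype.card_fin, Fintype.card_fin] at hE
  rw [Fintype.card_fin] at hU
  rw [maxPosIndex]
  omega

theorem maxRank_eq (hM : M.IsHermitian) (hD : D.IsHermitian) :
    maxRank (toEuclideanLin (N3 B C M D)) (inrLin (Fin n) (Fin m)).range (kerSpace m A) =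
      min ((N0 A B C M D).rank : ℤ) (min ((N1 A C M D).rank : ℤ) (N3 B C M D).rank) := by
  have h0 := rank_add_finrank_radical (hD.add (isHermitian_mul_mul_conjTranspose C hM))
    (C * M * Bᴴ) (isHermitian_mul_mul_conjTranspose B hM) A
  rw [← N3_eq B C hM, ← kerSpace, Fintype.card_fin] at h0
  have h1 := finrank_kerSpace (m := m) A
  have hU := finrank_range_inrLin (ι := Fin n) (κ := Fin m)
  have hE := finrank_euclideanSpace (𝕜 := ℂ) (ι := Fin n ⊕ Fin m)
  rw [Fintype.card_sum, Fintype.card_fin, Fintype.card_fin] at hE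
  rw [Fintype.card_fin] at hU
  rw [maxRank, N0, ← posInertia_add_negInertia _ (N1_isHermitian A C hM hD),
    ← posInertia_add_negInertia _ (N3_isHermitian B C hM hD), posInertia_N1 A B C hM hD,
    negInertia_N1 A B C hM hD, posInertia_eq_posIndex, negInertia_eq_posIndex]
  omega

/-- A sum of two maxima is the maximum of the four sums of entries; these are `s₁, …, s₄`. -/
theorem two_mul_add_max (r₀ r₂ r₄ i₁ j₁ i₃ j₃ : ℤ) :
    2 * r₀ + max (max (i₁ + j₁ - 2 * r₂) (i₃ + j₃ - 2 * r₄))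
      (max (i₁ + j₃ - r₂ - r₄) (j₁ + i₃ - r₂ - r₄)) =
      r₀ + max (i₁ - r₂) (i₃ - r₄) + (r₀ + max (j₁ - r₂) (j₃ - r₄)) := by
  omega

end Assembly

end QuadInertia

/-! ### The extremal ranks and inertias -/

open QuadInertia

theorem theorem4p1 (n p m q : ℕ)
    (A : Matrix (Fin n) (Fin p) ℂ) (B : Matrix (Fin m) (Fin q) ℂ)
    (C : Matrix (Fin n) (Fin q) ℂ) (M : Matrix (Fin q) (Fin q) ℂ)
    (D : Matrix (Fin n) (Fin n) ℂ) (hM : M.IsHermitian) (hD : D.IsHermitian) :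
    let φ : Matrix (Fin p) (Fin m) ℂ → Matrix (Fin n) (Fin n) ℂ := QuadInertia.phi A B C M D
    let hφ : ∀ X, (φ X).IsHermitian := QuadInertia.phi_isHermitian A B C hM hD
    let r₀ : ℤ := (QuadInertia.N0 A B C M D).rank
    let r₁ : ℤ := (QuadInertia.N1 A C M D).rank
    let r₂ : ℤ := (QuadInertia.N2 A B C M D).rank
    let r₃ : ℤ := (QuadInertia.N3 B C M D).rank
    let r₄ : ℤ := (QuadInertia.N4 A B C M D).rank
    let pos₁ : ℤ := QuadInertia.posInertia _ (QuadInertia.N1_isHermitian A C hM hD)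
    let neg₁ : ℤ := QuadInertia.negInertia _ (QuadInertia.N1_isHermitian A C hM hD)
    let pos₃ : ℤ := QuadInertia.posInertia _ (QuadInertia.N3_isHermitian B C hM hD)
    let neg₃ : ℤ := QuadInertia.negInertia _ (QuadInertia.N3_isHermitian B C hM hD)
    let s₁ : ℤ := r₁ - 2 * r₂
    let s₂ : ℤ := r₃ - 2 * r₄
    let s₃ : ℤ := pos₁ + neg₃ - r₂ - r₄
    let s₄ : ℤ := neg₁ + pos₃ - r₂ - r₄
    IsGreatest (Set.range fun X => ((φ X).rank : ℤ)) (min r₀ (min r₁ r₃)) ∧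
    IsLeast (Set.range fun X => ((φ X).rank : ℤ))
      (2 * r₀ + max (max s₁ s₂) (max s₃ s₄)) ∧
    IsGreatest (Set.range fun X => (QuadInertia.posInertia (φ X) (hφ X) : ℤ))
      (min pos₁ pos₃) ∧
    IsGreatest (Set.range fun X => (QuadInertia.negInertia (φ X) (hφ X) : ℤ))
      (min neg₁ neg₃) ∧
    IsLeast (Set.range fun X => (QuadInertia.posInertia (φ X) (hφ X) : ℤ))
      (r₀ + max (pos₁ - r₂) (pos₃ - r₄)) ∧
    IsLeast (Set.range fun X => (QuadInertia.negInertia (φ X) (hφ X) : ℤ))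
      (r₀ + max (neg₁ - r₂) (neg₃ - r₄)) := by
  intro φ hφ r₀ r₁ r₂ r₃ r₄ pos₁ neg₁ pos₃ neg₃ s₁ s₂ s₃ s₄
  set T := toEuclideanLin (N3 B C M D) with hTdef
  set K := kerSpace m A
  set U := (inrLin (Fin n) (Fin m)).range
  have hT : T.IsSymmetric := isSymmetric_toEuclideanLin (N3_isHermitian B C hM hD)
  have hT' := isSymmetric_neg hT
  have hKU : K ⊓ U = ⊥ := map_inlLin_inf_range
  have hpos : ∀ X, (posInertia (φ X) (hφ X) : ℤ) = posIndex T (graphSpace A X) := fun X =>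
    congrArg _ (posInertia_phi A B C hM hD X)
  have hneg : ∀ X, (negInertia (φ X) (hφ X) : ℤ) = posIndex (-T) (graphSpace A X) := fun X =>
    congrArg _ (negInertia_phi A B C hM hD X)
  have hrank : ∀ X, ((φ X).rank : ℤ) =
      posIndex T (graphSpace A X) + posIndex (-T) (graphSpace A X) := fun X => by
    rw [← hpos, ← hneg, ← posInertia_add_negInertia _ (hφ X), Nat.cast_add]
  have hW : ∀ {W}, K ≤ W → W ⊓ U = ⊥ → W ⊔ U = ⊤ →
      ∃ X : Matrix (Fin p) (Fin m) ℂ, graphSpace A X = W := fun h h' h'' =>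
    exists_eq_graph A h h' h''
  have g1 : ∀ X : Matrix (Fin p) (Fin m) ℂ, K ≤ graphSpace A X := ker_le_graph A
  have g2 : ∀ X : Matrix (Fin p) (Fin m) ℂ, graphSpace A X ⊓ U = ⊥ := fun X => graph_inf_range _
  have g3 : ∀ X : Matrix (Fin p) (Fin m) ℂ, graphSpace A X ⊔ U = ⊤ := fun X => graph_sup_range _
  have e1 : pos₁ = (A.rank + posIndex T K : ℕ) := congrArg _ (posInertia_N1 A B C hM hD)
  have e2 : neg₁ = (A.rank + posIndex (-T) K : ℕ) := congrArg _ (negInertia_N1 A B C hM hD)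
  have e3 : pos₃ = posIndex T ⊤ := congrArg _ (posInertia_eq_posIndex _ _)
  have e4 : neg₃ = posIndex (-T) ⊤ := congrArg _ (negInertia_eq_posIndex _ _)
  have e5 : r₁ = pos₁ + neg₁ :=
    (congrArg (Nat.cast : ℕ → ℤ) (posInertia_add_negInertia _ (N1_isHermitian A C hM hD)).symm).trans
      (Nat.cast_add _ _)
  have e6 : r₃ = pos₃ + neg₃ :=
    (congrArg (Nat.cast : ℕ → ℤ) (posInertia_add_negInertia _ (N3_isHermitian B C hM hD)).symm).trans
      (Nat.cast_add _ _)
  have m1 : minPosIndex T U K = r₀ + max (pos₁ - r₂) (pos₃ - r₄) := by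
    rw [e1, e3]
    exact minPosIndex_eq A B C hM hD fun _ => rfl
  have m2 : minPosIndex (-T) U K = r₀ + max (neg₁ - r₂) (neg₃ - r₄) := by
    rw [e2, e4]
    exact minPosIndex_eq A B C hM hD fun _ => formPerp_neg
  have M1 : maxPosIndex T U K = min pos₁ pos₃ := by rw [e1, e3]; exact maxPosIndex_eq A
  have M2 : maxPosIndex (-T) U K = min neg₁ neg₃ := by rw [e2, e4]; exact maxPosIndex_eq A
  have MR : maxRank T U K = min r₀ (min r₁ r₃) := maxRank_eq A B C hM hD
  have mR : 2 * r₀ + max (max s₁ s₂) (max s₃ s₄) = minPosIndex T U K + minPosIndex (-T) U K := by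
    change 2 * r₀ + max (max (r₁ - 2 * r₂) (r₃ - 2 * r₄))
      (max (pos₁ + neg₃ - r₂ - r₄) (neg₁ + pos₃ - r₂ - r₄)) = _
    rw [m1, m2, e5, e6]
    exact two_mul_add_max _ _ _ _ _ _ _
  have lb1 : ∀ X, minPosIndex T U K ≤ posIndex T (graphSpace A X) := fun X =>
    minPosIndex_le hT (g1 X) (g2 X) (g3 X)
  have lb2 : ∀ X, minPosIndex (-T) U K ≤ posIndex (-T) (graphSpace A X) := fun X =>
    minPosIndex_le hT' (g1 X) (g2 X) (g3 X)
  -- This common minimizer, the graph for `X₀`, attains the minima of `i₊`, of `i₋` and hence of the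
  -- rank.
  obtain ⟨W, hK, hWU, htop, hWp, hWn⟩ := exists_minPosIndex hT hKU
  obtain ⟨X₀, rfl⟩ := hW hK hWU htop
  refine ⟨⟨?_, ?_⟩, ⟨?_, ?_⟩, ⟨?_, ?_⟩, ⟨?_, ?_⟩, ⟨?_, ?_⟩, ⟨?_, ?_⟩⟩
  · obtain ⟨W, hK, hWU, htop, hW'⟩ := exists_maxRank hT hKU
    obtain ⟨X, rfl⟩ := hW hK hWU htop
    exact ⟨X, by rw [← MR, ← hW', ← hrank]⟩
  · rintro _ ⟨X, rfl⟩
    rw [← MR]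
    exact (hrank X).trans_le (rank_le_maxRank hT (g1 X) (g2 X) (g3 X))
  · exact ⟨X₀, by rw [mR, ← hWp, ← hWn, ← hrank]⟩
  · rintro _ ⟨X, rfl⟩
    rw [mR]
    exact (add_le_add (lb1 X) (lb2 X)).trans_eq (hrank X).symm
  · obtain ⟨W, hK, hWU, htop, hW'⟩ := exists_maxPosIndex hT hKU
    obtain ⟨X, rfl⟩ := hW hK hWU htop
    exact ⟨X, by rw [← M1, ← hW', ← hpos]⟩
  · rintro _ ⟨X, rfl⟩
    rw [← M1]
    exact (hpos X).trans_le (posIndex_le_maxPosIndex (g1 X) (g2 X) (g3 X))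
  · obtain ⟨W, hK, hWU, htop, hW'⟩ := exists_maxPosIndex hT' hKU
    obtain ⟨X, rfl⟩ := hW hK hWU htop
    exact ⟨X, by rw [← M2, ← hW', ← hneg]⟩
  · rintro _ ⟨X, rfl⟩
    rw [← M2]
    exact (hneg X).trans_le (posIndex_le_maxPosIndex (g1 X) (g2 X) (g3 X))
  · exact ⟨X₀, by rw [← m1, ← hWp, ← hpos]⟩
  · rintro _ ⟨X, rfl⟩
    rw [← m1]
    exact (lb1 X).trans_eq (hpos X).symm
  · exact ⟨X₀, by rw [← m2, ← hWn, ← hneg]⟩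
  · rintro _ ⟨X, rfl⟩
    rw [← m2]
    exact (lb2 X).trans_eq (hneg X).symm
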